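/- **Setting.** A metric language $\mathcal L$ has a set of sorts $S$, each with a bound $B_S>0$; function symbols $f$ (constants included), each with a finite product of sorts as domain, a sort as co-domain, and a uniform continuity modulus; and relation symbols $R$, each with a finite product of sorts as domain, a bound $B_R>0$ and a modulus. A modulus is a continuous increasing function $\delta:[0,1]\to[0,1]$ with $\delta(0)=0$ and $\delta(\epsilon)>0$ for $\epsilon>0$. An $\mathcal L$-structure $\mathcal M$ interprets each sort $S$ as a non-empty complete metric space $S^{\mathcal M}$ of diameter at most $B_S$, and the symbols as functions $f^{\mathcal M}$ and $R^{\mathcal M}$ (the latter with values in $[-B_R,B_R]$) such that, whenever $0<\epsilon\le 1$ and the coordinates of two arguments are at distance less than $\delta(\epsilon)$, the values are at distance at most $\epsilon$. It is separable if every $S^{\mathcal M}$ is separable. Basic formulas are built from $R(\tau_1,\dots,\tau_n)$ and $d_S(\tau_1,\tau_2)$, where the $\tau_i$ are terms, using all continuous functions $\mathbb R^k\to\mathbb R$ as connectives and the quantifiers $\sup_x$ and $\inf_x$. For a set $T$ of basic sentences, $\mathcal M\models T$ means $\sigma^{\mathcal M}=0$ for all $\sigma\in T$; $T$ is a theory if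 it has a model. Theories are not assumed to be complete. For a finite tuple of sorted variables $\bar x$, let $\mathrm{Form}_{\bar x}(\mathcal L)$ be the completion of the set of basic formulas in $\bar x$ for the pseudometric $\sup\{|\varphi^{\mathcal M}(\bar a)-\psi^{\mathcal M}(\bar a)|\}$, the supremum being over all $\mathcal L$-structures $\mathcal M$ and all $\bar a\in\mathcal M$. The language $\mathcal L$ is separable if the sum over all $\bar x$ of the density characters of $\mathrm{Form}_{\bar x}(\mathcal L)$ is $\aleph_0$. A complete type of $T$ in $\bar x$ is a function $p=\mathrm{tp}^{\mathcal M}(\bar a):\varphi(\bar x)\mapsto\varphi^{\mathcal M}(\bar a)$, where $\mathcal M\models T$ and $\bar a\in\mathcal M$. A tuple $\bar b\in\mathcal N$ realizes $p$ if $\mathrm{tp}^{\mathcal N}(\bar b)=p$; $p(\mathcal N)$ is the set of realizations of $p$ in $\mathcal N$; and $\mathcal N$ omits $p$ if $p(\mathcal N)=\emptyset$. The type $p$ is principal relative to $T$ if $\mathcal M\mapsto p(\mathcal M)$ is a $T$-definable set, that is: for every $\epsilon>0$ there are a basic formula $\varphi(\bar x)$ and $\delta>0$ such that, for every $\mathcal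 M\models T$, $\varphi^{\mathcal M}=0$ on $p(\mathcal M)$, and every $\bar a\in\mathcal M$ with $\varphi^{\mathcal M}(\bar a)<\delta$ satisfies $d(\bar a,p(\mathcal M))\le\epsilon$. Here tuples carry the maximum metric and $d(\bar a,\emptyset)=\infty$. **Omitting types theorem.** Let $T$ be a theory in a separable metric language $\mathcal L$, and let $(p_k)_{k\in I}$ be a countable family of complete types of $T$, each in some finite tuple of variables, none of which is principal relative to $T$. Then $T$ has a separable model which omits every $p_k$. -/

import Mathlib

universe u w

/-- A uniform continuity modulus: an increasing continuous function `[0,1] → [0,1]` which tends to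
`0` at `0` and is positive at every positive `ε`. -/
structure UCModulus where
  toFun : unitInterval → unitInterval
  monotone' : Monotone toFun
  continuous' : Continuous toFun
  map_zero' : toFun 0 = 0
  pos' : ∀ ε, 0 < ε → 0 < toFun ε

/-- A (many-sorted) metric language. The metric symbol on each sort is not listed among the
relation symbols; it is a logical symbol of every language (see `BasicFormula.dist`). A constant
symbol is a function symbol of arity `0`. -/
structure MetricLanguage where
  Sorts : Type u
  /-- the bound `B_S` on the diameter of the sort `S` -/
  sortBound : Sorts → ℝ
  sortBound_pos : ∀ s, 0 < sortBound s
  Func : Type u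
  funArity : Func → ℕ
  funDom : (f : Func) → Fin (funArity f) → Sorts
  funCod : Func → Sorts
  funMod : Func → UCModulus
  Rel : Type u
  relArity : Rel → ℕ
  relDom : (R : Rel) → Fin (relArity R) → Sorts
  relBound : Rel → ℝ
  relBound_pos : ∀ R, 0 < relBound R
  relMod : Rel → UCModulus

namespace MetricLanguage

/-- An `L`-structure: complete nonempty bounded metric spaces for the sorts, and uniformly
continuous functions and real-valued relations obeying the moduli and bounds of the language. -/
structure Structure (L : MetricLanguage.{u}) where
  Carrier : L.Sorts → Type w
  [metric : ∀ s, MetricSpace (Carrier s)]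
  [complete : ∀ s, CompleteSpace (Carrier s)]
  [nonempty : ∀ s, Nonempty (Carrier s)]
  dist_le : ∀ s (a b : Carrier s), dist a b ≤ L.sortBound s
  funMap : ∀ f : L.Func, (∀ i, Carrier (L.funDom f i)) → Carrier (L.funCod f)
  funMap_uc : ∀ (f : L.Func) (ε : unitInterval), 0 < ε → ∀ a b : ∀ i, Carrier (L.funDom f i),
    (∀ i, dist (a i) (b i) < ((L.funMod f).toFun ε : ℝ)) →
      dist (funMap f a) (funMap f b) ≤ (ε : ℝ)
  relMap : ∀ R : L.Rel, (∀ i, Carrier (L.relDom R i)) → ℝ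
  relMap_bound : ∀ (R : L.Rel) (a : ∀ i, Carrier (L.relDom R i)), |relMap R a| ≤ L.relBound R
  relMap_uc : ∀ (R : L.Rel) (ε : unitInterval), 0 < ε → ∀ a b : ∀ i, Carrier (L.relDom R i),
    (∀ i, dist (a i) (b i) < ((L.relMod R).toFun ε : ℝ)) →
      |relMap R a - relMap R b| ≤ (ε : ℝ)

attribute [instance] Structure.metric Structure.complete Structure.nonempty

variable {L : MetricLanguage.{u}}

/-- Terms in the tuple of variables `x_0, …, x_{n-1}`, where `x_i` has sort `Γ i`, indexed by
their co-domain. -/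
inductive Term {n : ℕ} (Γ : Fin n → L.Sorts) : L.Sorts → Type u
  | var (i : Fin n) : Term Γ (Γ i)
  | func (f : L.Func) (ts : ∀ i, Term Γ (L.funDom f i)) : Term Γ (L.funCod f)

/-- The sorts of the tuple `(y, x_0, …, x_{n-1})` when `y` has sort `s` and `x_i` sort `Γ i`. -/
def consSort {n : ℕ} (s : L.Sorts) (Γ : Fin n → L.Sorts) : Fin (n + 1) → L.Sorts :=
  Fin.cons s Γ

/-- Basic formulas whose free variables are among `x_0, …, x_{n-1}`, where `x_i` has sort `Γ i`.
Connectives are all continuous functions `ℝ ^ k → ℝ`; a quantifier binds a new variable put in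
front of the tuple. -/
inductive BasicFormula : {n : ℕ} → (Fin n → L.Sorts) → Type u
  | rel {n : ℕ} {Γ : Fin n → L.Sorts} (R : L.Rel) (ts : ∀ i, Term Γ (L.relDom R i)) :
      BasicFormula Γ
  | dist {n : ℕ} {Γ : Fin n → L.Sorts} {s : L.Sorts} (t₁ t₂ : Term Γ s) : BasicFormula Γ
  | conn {n : ℕ} {Γ : Fin n → L.Sorts} {k : ℕ} (f : C(Fin k → ℝ, ℝ))
      (φ : Fin k → BasicFormula Γ) : BasicFormula Γ
  | sup {n : ℕ} {Γ : Fin n → L.Sorts} (s : L.Sorts) (φ : BasicFormula (consSort s Γ)) :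
      BasicFormula Γ
  | inf {n : ℕ} {Γ : Fin n → L.Sorts} (s : L.Sorts) (φ : BasicFormula (consSort s Γ)) :
      BasicFormula Γ

/-- Basic sentences. -/
abbrev Sentence (L : MetricLanguage.{u}) : Type u :=
  BasicFormula (Fin.elim0 : Fin 0 → L.Sorts)

/-- Tuples of elements of `M` whose sorts are given by `Γ`, with the maximum metric. -/
abbrev Structure.Tuple (M : Structure.{u, w} L) {n : ℕ} (Γ : Fin n → L.Sorts) : Type w :=
  ∀ i, M.Carrier (Γ i)

/-- The tuple `(b, a_0, …, a_{n-1})`. -/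
def Structure.cons (M : Structure.{u, w} L) {n : ℕ} {Γ : Fin n → L.Sorts} {s : L.Sorts}
    (b : M.Carrier s) (a : M.Tuple Γ) : M.Tuple (consSort s Γ) :=
  Fin.cons (α := fun i => M.Carrier (consSort s Γ i)) b a

/-- The interpretation of a term in a structure. -/
def Term.eval (M : Structure.{u, w} L) {n : ℕ} {Γ : Fin n → L.Sorts} (a : M.Tuple Γ) :
    {s : L.Sorts} → Term Γ s → M.Carrier s
  | _, .var i => a i
  | _, .func f ts => M.funMap f (fun i => (ts i).eval M a)

/-- The interpretation `φ^M(a)` of a basic formula in a structure. -/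
noncomputable def BasicFormula.eval (M : Structure.{u, w} L) :
    {n : ℕ} → {Γ : Fin n → L.Sorts} → BasicFormula Γ → M.Tuple Γ → ℝ
  | _, _, .rel R ts, a => M.relMap R (fun i => (ts i).eval M a)
  | _, _, .dist t₁ t₂, a => Dist.dist (t₁.eval M a) (t₂.eval M a)
  | _, _, .conn f φ, a => f (fun i => (φ i).eval M a)
  | _, _, .sup s φ, a => ⨆ b : M.Carrier s, φ.eval M (M.cons b a)
  | _, _, .inf s φ, a => ⨅ b : M.Carrier s, φ.eval M (M.cons b a)

/-- Every basic formula is bounded, uniformly in all structures; in particular the real suprema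
and infima in `BasicFormula.eval` are those of bounded nonempty sets. -/
theorem BasicFormula.exists_bound {n : ℕ} {Γ : Fin n → L.Sorts} (φ : BasicFormula Γ) :
    ∃ B : ℝ, ∀ (M : Structure.{u, w} L) (a : M.Tuple Γ), |φ.eval M a| ≤ B := by
  induction φ with
  | rel R ts => exact ⟨L.relBound R, fun M a => M.relMap_bound R _⟩
  | @dist n Γ s t₁ t₂ =>
    refine ⟨L.sortBound s, fun M a => ?_⟩
    simp only [BasicFormula.eval]
    rw [abs_of_nonneg dist_nonneg]
    exact M.dist_le s _ _
  | conn f φ ih =>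
    choose B hB using ih
    obtain ⟨C, hC⟩ := (isCompact_univ_pi (fun i => isCompact_Icc (a := -B i) (b := B i))).exists_bound_of_continuousOn
      f.continuous.continuousOn
    refine ⟨C, fun M a => ?_⟩
    simp only [BasicFormula.eval]
    exact hC _ (fun i _ => abs_le.mp (hB i M a))
  | sup s φ ih =>
    obtain ⟨B, hB⟩ := ih
    refine ⟨B, fun M a => ?_⟩
    have h : ∀ b : M.Carrier s, -B ≤ φ.eval M (M.cons b a) ∧ φ.eval M (M.cons b a) ≤ B :=
      fun b => abs_le.mp (hB M _)
    obtain ⟨b⟩ := M.nonempty s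
    simp only [BasicFormula.eval]
    exact abs_le.mpr ⟨(h b).1.trans (le_ciSup (f := fun b => φ.eval M (M.cons b a))
      ⟨B, by rintro _ ⟨c, rfl⟩; exact (h c).2⟩ b), ciSup_le fun c => (h c).2⟩
  | inf s φ ih =>
    obtain ⟨B, hB⟩ := ih
    refine ⟨B, fun M a => ?_⟩
    have h : ∀ b : M.Carrier s, -B ≤ φ.eval M (M.cons b a) ∧ φ.eval M (M.cons b a) ≤ B :=
      fun b => abs_le.mp (hB M _)
    obtain ⟨b⟩ := M.nonempty s
    simp only [BasicFormula.eval]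
    exact abs_le.mpr ⟨le_ciInf fun c => (h c).1, (ciInf_le (f := fun b => φ.eval M (M.cons b a))
      ⟨-B, by rintro _ ⟨c, rfl⟩; exact (h c).1⟩ b).trans (h b).2⟩

/-- `M` satisfies the set of sentences `T`: every sentence of `T` has value `0` in `M`. -/
def Structure.Models (M : Structure.{u, w} L) (T : Set L.Sentence) : Prop :=
  ∀ σ ∈ T, BasicFormula.eval M σ (fun i => i.elim0) = 0

/-- A theory is a satisfiable set of sentences. -/
def IsTheory (T : Set L.Sentence) : Prop :=
  ∃ M : Structure.{u, w} L, M.Models T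

/-! ### Separable languages -/

/-- The distance `‖φ - ψ‖_T = sup |φ^M(a) - ψ^M(a)|`, over all models `M` of `T` and all tuples `a`
of `M`, as a pseudometric on the set of basic formulas in the variables `Γ`. -/
@[reducible] noncomputable def formulaPseudoEMetric (T : Set L.Sentence) {n : ℕ} (Γ : Fin n → L.Sorts) :
    PseudoEMetricSpace (BasicFormula Γ) where
  edist φ ψ := ⨆ (M : Structure.{u, w} L) (_ : M.Models T) (a : M.Tuple Γ),
    ENNReal.ofReal |φ.eval M a - ψ.eval M a|
  edist_self φ := by simp
  edist_comm φ ψ := by simp only [abs_sub_comm]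
  edist_triangle φ ψ χ := by
    refine iSup_le fun M => iSup_le fun hM => iSup_le fun a => ?_
    refine (ENNReal.ofReal_le_ofReal
      (abs_sub_le (φ.eval M a) (ψ.eval M a) (χ.eval M a))).trans ?_
    rw [ENNReal.ofReal_add (abs_nonneg _) (abs_nonneg _)]
    refine add_le_add ?_ ?_
    · exact le_iSup_of_le M (le_iSup_of_le hM (le_iSup_of_le a le_rfl))
    · exact le_iSup_of_le M (le_iSup_of_le hM (le_iSup_of_le a le_rfl))

/-- The space of `T`-formulas in the variables `Γ`: the (Hausdorff) completion of the space of
basic formulas. -/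
def TFormula (T : Set L.Sentence) {n : ℕ} (Γ : Fin n → L.Sorts) : Type u :=
  @UniformSpace.Completion (BasicFormula Γ) (formulaPseudoEMetric.{u, w} T Γ).toUniformSpace

noncomputable instance (T : Set L.Sentence) {n : ℕ} (Γ : Fin n → L.Sorts) :
    UniformSpace (TFormula.{u, w} T Γ) :=
  @UniformSpace.Completion.uniformSpace (BasicFormula Γ)
    (formulaPseudoEMetric.{u, w} T Γ).toUniformSpace

/-- The density character of a topological space: the least cardinality of a dense subset. -/
noncomputable def densityChar (X : Type u) [TopologicalSpace X] : Cardinal.{u} :=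
  sInf {κ | ∃ D : Set X, Dense D ∧ Cardinal.mk D = κ}

/-- The density character of the language with respect to `T`: the sum, over all finite tuples of
variables, of the density characters of the spaces of `T`-formulas in these variables. -/
noncomputable def langDensityChar (T : Set L.Sentence) : Cardinal.{u} :=
  Cardinal.sum fun Γ : (Σ n : ℕ, (Fin n → L.Sorts)) => densityChar (TFormula.{u, w} T Γ.2)

/-- A language is separable if its density character with respect to the empty theory is `ℵ₀`. -/
def IsSeparableLanguage (L : MetricLanguage.{u}) : Prop :=
  langDensityChar.{u, w} (∅ : Set L.Sentence) = Cardinal.aleph0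

/-- A structure is separable if all of its sorts are. -/
def Structure.IsSeparable (M : Structure.{u, w} L) : Prop :=
  ∀ s, TopologicalSpace.SeparableSpace (M.Carrier s)

/-! ### Types, definable sets and principal types -/

/-- The complete type `φ ↦ φ^M(a)` of the tuple `a` in `M`. -/
noncomputable def Structure.tp (M : Structure.{u, w} L) {n : ℕ} {Γ : Fin n → L.Sorts}
    (a : M.Tuple Γ) : BasicFormula Γ → ℝ :=
  fun φ => φ.eval M a

/-- The space `S_Γ(T)` of complete types of `T` in the variables `Γ`. -/
def typeSpace (T : Set L.Sentence) {n : ℕ} (Γ : Fin n → L.Sorts) : Set (BasicFormula Γ → ℝ) :=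
  {p | ∃ (M : Structure.{u, w} L) (_ : M.Models T) (a : M.Tuple Γ), M.tp a = p}

/-- The set of realizations of `p` in `M`. -/
def Structure.realizations (M : Structure.{u, w} L) {n : ℕ} {Γ : Fin n → L.Sorts}
    (p : BasicFormula Γ → ℝ) : Set (M.Tuple Γ) :=
  {a | M.tp a = p}

/-- `M` omits `p`: no tuple of `M` realizes `p`. -/
def Structure.Omits (M : Structure.{u, w} L) {n : ℕ} {Γ : Fin n → L.Sorts}
    (p : BasicFormula Γ → ℝ) : Prop :=
  ¬ ∃ a : M.Tuple Γ, M.tp a = p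

/-- The assignment `M ↦ X M` of a set of tuples to each model of `T` is a `T`-definable set: for
every `ε > 0` there are a basic formula `φ` and `δ > 0` such that in all models `M` of `T`, `φ`
vanishes on `X M`, and `φ^M(a) < δ` implies `d(a, X M) ≤ ε`. The distance to the empty set
is `∞`. -/
def IsDefinable (T : Set L.Sentence) {n : ℕ} (Γ : Fin n → L.Sorts)
    (X : ∀ M : Structure.{u, w} L, Set (M.Tuple Γ)) : Prop :=
  ∀ ε : ℝ, 0 < ε → ∃ (φ : BasicFormula Γ) (δ : ℝ), 0 < δ ∧
    ∀ M : Structure.{u, w} L, M.Models T →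
      (∀ a ∈ X M, φ.eval M a = 0) ∧
      ∀ a : M.Tuple Γ, φ.eval M a < δ → Metric.infEDist a (X M) ≤ ENNReal.ofReal ε

/-- A type is principal relative to `T` if its sets of realizations in the models of `T` form a
`T`-definable set. -/
def IsPrincipal (T : Set L.Sentence) {n : ℕ} {Γ : Fin n → L.Sorts}
    (p : BasicFormula Γ → ℝ) : Prop :=
  IsDefinable.{u, w} T Γ (fun M => M.realizations p)

end MetricLanguage

section

open Filter Topology

/-! Adjoin countably many constants of each sort, and topologize the models of `T` with named
constants by the values of all sentences with constants (`NamedModel.diagram`). By Łoś's theorem the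
diagram of an ultraproduct is the ultralimit of the diagrams. Sequences therefore have limits within
the space, which gives the Baire category theorem `NamedModel.exists_generic`. It remains to impose
countably many dense open conditions which make the closure of the constants the desired model.

The Henkin conditions ask that suprema be nearly attained at constants. They are dense because a
constant not yet mentioned can be reinterpreted at will, and separability of the language makes
countably many of them sufficient. By the Tarski–Vaught test `eval_constSubstructure`, the closure
of the constants is then an elementary substructure, and it is visibly separable.

The omitting conditions keep every tuple of constants at distance more than a fixed `η / 3` from the
type `p`. The radius comes from `isPrincipal_of_isNear`: if every metric neighbourhood of `p`
contained a logical one, then successive approximations would converge to realizations of `p`,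
making `p` principal. So for some `η` no logical neighbourhood of `p` stays within `η` of `p`, and
this gives density (`isDenseOpen_omittingSet`). A realization of `p` in the closure would have
constants within `η / 3` of it, a contradiction (`omits_of_mem_omittingSet`).

Formulas needed along the way are built semantically, with named variables, through
`IsFormulaValue`. -/

theorem exists_pos_forall_le {ι : Type*} [Finite ι] (δ : ι → ℝ) (h : ∀ i, 0 < δ i) :
    ∃ d : ℝ, 0 < d ∧ ∀ i, d ≤ δ i := by
  have h1 : ∀ᶠ d in 𝓝[>] (0 : ℝ), ∀ i, d ≤ δ i :=
    eventually_all.2 fun i => nhdsWithin_le_nhds (eventually_le_nhds (h i))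
  obtain ⟨d, hd, hd'⟩ := (h1.and self_mem_nhdsWithin).exists
  exact ⟨d, hd', hd⟩

theorem ciSup_le_ciSup_add {ι : Type*} [Nonempty ι] {f g : ι → ℝ} {ε : ℝ}
    (hg : BddAbove (Set.range g)) (h : ∀ i, f i ≤ g i + ε) : ⨆ i, f i ≤ (⨆ i, g i) + ε :=
  ciSup_le fun i => (h i).trans (by linarith [le_ciSup hg i])

theorem ciInf_le_ciInf_add {ι : Type*} [Nonempty ι] {f g : ι → ℝ} {ε : ℝ}
    (hf : BddBelow (Set.range f)) (h : ∀ i, f i ≤ g i + ε) : ⨅ i, f i ≤ (⨅ i, g i) + ε := by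
  have : (⨅ i, f i) - ε ≤ ⨅ i, g i :=
    le_ciInf fun i => by linarith [ciInf_le hf i, h i]
  linarith

theorem UCModulus.coe_pos (m : UCModulus) {e : unitInterval} (he : 0 < e) :
    (0 : ℝ) < (m.toFun e : ℝ) := m.pos' e he

/-! ### Uniform continuity of terms and formulas, with moduli common to all structures. -/

namespace MetricLanguage

variable {L : MetricLanguage.{u}}

namespace Structure

variable (M : Structure.{u, w} L)

theorem dist_cons_lt {n : ℕ} {Γ : Fin n → L.Sorts} {s : L.Sorts} (b : M.Carrier s)
    {a a' : M.Tuple Γ} {δ : ℝ} (hδ : 0 < δ) (h : ∀ i, dist (a i) (a' i) < δ) (i : Fin (n + 1)) :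
    dist (M.cons b a i) (M.cons b a' i) < δ := by
  refine Fin.cases ?_ (fun i => ?_) i
  · exact (dist_self b).trans_lt hδ
  · exact h i

end Structure

namespace BasicFormula

theorem bddAbove_range {n : ℕ} {Γ : Fin n → L.Sorts} {s : L.Sorts}
    (φ : BasicFormula (consSort s Γ)) (M : Structure.{u, w} L) (a : M.Tuple Γ) :
    BddAbove (Set.range fun b : M.Carrier s => φ.eval M (M.cons b a)) := by
  obtain ⟨B, hB⟩ := φ.exists_bound
  exact ⟨B, by rintro _ ⟨b, rfl⟩; exact (abs_le.1 (hB M _)).2⟩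

theorem bddBelow_range {n : ℕ} {Γ : Fin n → L.Sorts} {s : L.Sorts}
    (φ : BasicFormula (consSort s Γ)) (M : Structure.{u, w} L) (a : M.Tuple Γ) :
    BddBelow (Set.range fun b : M.Carrier s => φ.eval M (M.cons b a)) := by
  obtain ⟨B, hB⟩ := φ.exists_bound
  exact ⟨-B, by rintro _ ⟨b, rfl⟩; exact (abs_le.1 (hB M _)).1⟩

theorem le_eval_sup {n : ℕ} {Γ : Fin n → L.Sorts} {s : L.Sorts}
    (φ : BasicFormula (consSort s Γ)) (M : Structure.{u, w} L) (a : M.Tuple Γ)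
    (b : M.Carrier s) : φ.eval M (M.cons b a) ≤ (BasicFormula.sup s φ).eval M a :=
  le_ciSup (φ.bddAbove_range M a) b

theorem eval_inf_le {n : ℕ} {Γ : Fin n → L.Sorts} {s : L.Sorts}
    (φ : BasicFormula (consSort s Γ)) (M : Structure.{u, w} L) (a : M.Tuple Γ)
    (b : M.Carrier s) : (BasicFormula.inf s φ).eval M a ≤ φ.eval M (M.cons b a) :=
  ciInf_le (φ.bddBelow_range M a) b

end BasicFormula

/-- Positive reals provide elements of the unit interval below them. -/
theorem exists_unitInterval_lt {ε : ℝ} (hε : 0 < ε) :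
    ∃ e : unitInterval, 0 < e ∧ (e : ℝ) < ε := by
  refine ⟨⟨min (ε / 2) 1, by positivity, min_le_right _ _⟩, ?_, ?_⟩
  · exact Subtype.coe_lt_coe.1 (show (0 : ℝ) < min (ε / 2) 1 by positivity)
  · exact (min_le_left _ _).trans_lt (by linarith)

/-- Terms are uniformly continuous, uniformly in all structures. -/
theorem Term.uniformContinuous {n : ℕ} {Γ : Fin n → L.Sorts} {s : L.Sorts} (t : Term Γ s) :
    ∀ ε : ℝ, 0 < ε → ∃ δ : ℝ, 0 < δ ∧ ∀ (M : Structure.{u, w} L) (a b : M.Tuple Γ),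
      (∀ i, dist (a i) (b i) < δ) → dist (t.eval M a) (t.eval M b) < ε := by
  induction t with
  | var i => exact fun ε hε => ⟨ε, hε, fun M a b h => h i⟩
  | func f ts ih =>
    intro ε hε
    -- The axioms of a structure only give `≤ e`, so `e` is taken strictly below `ε`; this also
    -- handles `ε > 1`.
    obtain ⟨e, he, heε⟩ := exists_unitInterval_lt hε
    choose δ hδ h using fun i => ih i _ ((L.funMod f).coe_pos he)
    obtain ⟨d, hd, hdδ⟩ := exists_pos_forall_le δ hδ
    refine ⟨d, hd, fun M a b hab => ?_⟩
    simp only [Term.eval]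
    exact (M.funMap_uc f e he _ _ fun i =>
      h i M a b fun j => (hab j).trans_le (hdδ i)).trans_lt heε

/-- Basic formulas are uniformly continuous, uniformly in all structures. -/
theorem BasicFormula.uniformContinuous {n : ℕ} {Γ : Fin n → L.Sorts} (φ : BasicFormula Γ) :
    ∀ ε : ℝ, 0 < ε → ∃ δ : ℝ, 0 < δ ∧ ∀ (M : Structure.{u, w} L) (a b : M.Tuple Γ),
      (∀ i, Dist.dist (a i) (b i) < δ) → |φ.eval M a - φ.eval M b| < ε := by
  induction φ with
  | rel R ts =>
    intro ε hε
    obtain ⟨e, he, heε⟩ := exists_unitInterval_lt hε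
    choose δ hδ h using fun i => (ts i).uniformContinuous _ ((L.relMod R).coe_pos he)
    obtain ⟨d, hd, hdδ⟩ := exists_pos_forall_le δ hδ
    refine ⟨d, hd, fun M a b hab => ?_⟩
    simp only [BasicFormula.eval]
    exact (M.relMap_uc R e he _ _ fun i =>
      h i M a b fun j => (hab j).trans_le (hdδ i)).trans_lt heε
  | dist t₁ t₂ =>
    intro ε hε
    obtain ⟨δ₁, h₁, H₁⟩ := t₁.uniformContinuous (ε / 2) (by positivity)
    obtain ⟨δ₂, h₂, H₂⟩ := t₂.uniformContinuous (ε / 2) (by positivity)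
    refine ⟨min δ₁ δ₂, lt_min h₁ h₂, fun M a b hab => ?_⟩
    have e₁ := H₁ M a b fun i => (hab i).trans_le (min_le_left _ _)
    have e₂ := H₂ M a b fun i => (hab i).trans_le (min_le_right _ _)
    simp only [BasicFormula.eval]
    have := dist_dist_dist_le (t₁.eval M a) (t₂.eval M a) (t₁.eval M b) (t₂.eval M b)
    rw [Real.dist_eq] at this
    linarith
  | conn f φ ih =>
    intro ε hε
    choose B hB using fun i => (φ i).exists_bound
    -- The bounds do not depend on the structure, so one compact box contains all arguments of `f`.
    have hu := (isCompact_univ_pi fun i =>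
      isCompact_Icc (a := -B i) (b := B i)).uniformContinuousOn_of_continuous
        f.continuous.continuousOn
    obtain ⟨η, hη, hf⟩ := Metric.uniformContinuousOn_iff.1 hu ε hε
    choose δ hδ h using fun i => ih i η hη
    obtain ⟨d, hd, hdδ⟩ := exists_pos_forall_le δ hδ
    refine ⟨d, hd, fun M a b hab => ?_⟩
    simp only [BasicFormula.eval]
    refine hf _ (fun i _ => abs_le.mp (hB i M a)) _ (fun i _ => abs_le.mp (hB i M b)) ?_
    exact (dist_pi_lt_iff hη).2 fun i => h i M a b fun j => (hab j).trans_le (hdδ i)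
  | sup s φ ih =>
    intro ε hε
    obtain ⟨δ, hδ, h⟩ := ih (ε / 2) (by positivity)
    refine ⟨δ, hδ, fun M a b hab => ?_⟩
    simp only [BasicFormula.eval]
    have key := fun c : M.Carrier s => abs_lt.1 (h M _ _ (M.dist_cons_lt c hδ hab))
    have h₁ := ciSup_le_ciSup_add (φ.bddAbove_range M b) (ε := ε / 2)
      (f := fun c => φ.eval M (M.cons c a)) fun c => by linarith [(key c).2]
    have h₂ := ciSup_le_ciSup_add (φ.bddAbove_range M a) (ε := ε / 2)
      (f := fun c => φ.eval M (M.cons c b)) fun c => by linarith [(key c).1]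
    exact abs_lt.2 ⟨by linarith, by linarith⟩
  | inf s φ ih =>
    intro ε hε
    obtain ⟨δ, hδ, h⟩ := ih (ε / 2) (by positivity)
    refine ⟨δ, hδ, fun M a b hab => ?_⟩
    simp only [BasicFormula.eval]
    have key := fun c : M.Carrier s => abs_lt.1 (h M _ _ (M.dist_cons_lt c hδ hab))
    have h₁ := ciInf_le_ciInf_add (φ.bddBelow_range M a) (ε := ε / 2)
      (g := fun c => φ.eval M (M.cons c b)) fun c => by linarith [(key c).2]
    have h₂ := ciInf_le_ciInf_add (φ.bddBelow_range M b) (ε := ε / 2)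
      (g := fun c => φ.eval M (M.cons c a)) fun c => by linarith [(key c).1]
    exact abs_lt.2 ⟨by linarith, by linarith⟩

/-! ### Substitution -/

/-- Substitution of terms for the variables of a term. -/
def Term.subst {n m : ℕ} {Γ : Fin n → L.Sorts} {Δ : Fin m → L.Sorts}
    (σ : ∀ i, Term Δ (Γ i)) : {s : L.Sorts} → Term Γ s → Term Δ s
  | _, .var i => σ i
  | _, .func f ts => .func f fun i => (ts i).subst σ

theorem Term.eval_subst {n m : ℕ} {Γ : Fin n → L.Sorts} {Δ : Fin m → L.Sorts}
    (σ : ∀ i, Term Δ (Γ i)) {s : L.Sorts} (t : Term Γ s) (M : Structure.{u, w} L)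
    (a : M.Tuple Δ) : (t.subst σ).eval M a = t.eval M fun i => (σ i).eval M a := by
  induction t with
  | var i => rfl
  | func f ts ih => simp only [Term.subst, Term.eval, ih]

/-- The variable of index `0` in an extended context. -/
def Term.varZero {n : ℕ} {Γ : Fin n → L.Sorts} (s : L.Sorts) : Term (consSort s Γ) s :=
  .var (Γ := consSort s Γ) 0

/-- The variables of the original context in an extended context. -/
def Term.varSucc {n : ℕ} {Γ : Fin n → L.Sorts} (s : L.Sorts) (i : Fin n) :
    Term (consSort s Γ) (Γ i) :=
  .var (Γ := consSort s Γ) i.succ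

/-- The substitution under a quantifier which fixes the bound variable. -/
def liftSubst {n m : ℕ} {Γ : Fin n → L.Sorts} {Δ : Fin m → L.Sorts} (s : L.Sorts)
    (σ : ∀ i, Term Δ (Γ i)) (i : Fin (n + 1)) : Term (consSort s Δ) (consSort s Γ i) :=
  Fin.cases (motive := fun i => Term (consSort s Δ) (consSort s Γ i)) (Term.varZero s)
    (fun i => (σ i).subst (Term.varSucc s)) i

theorem eval_liftSubst {n m : ℕ} {Γ : Fin n → L.Sorts} {Δ : Fin m → L.Sorts} (s : L.Sorts)
    (σ : ∀ i, Term Δ (Γ i)) (M : Structure.{u, w} L) (b : M.Carrier s) (a : M.Tuple Δ) :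
    (fun i => (liftSubst s σ i).eval M (M.cons b a)) =
      M.cons b fun i => (σ i).eval M a := by
  funext i
  refine Fin.cases ?_ (fun i => ?_) i
  · rfl
  · exact Term.eval_subst _ (σ i) M (M.cons b a)

/-- Substitution of terms for the free variables of a basic formula. -/
def BasicFormula.subst : {n m : ℕ} → {Γ : Fin n → L.Sorts} → {Δ : Fin m → L.Sorts} →
    (∀ i, Term Δ (Γ i)) → BasicFormula Γ → BasicFormula Δ
  | _, _, _, _, σ, .rel R ts => .rel R fun i => (ts i).subst σ
  | _, _, _, _, σ, .dist t₁ t₂ => .dist (t₁.subst σ) (t₂.subst σ)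
  | _, _, _, _, σ, .conn f φ => .conn f fun i => (φ i).subst σ
  | _, _, _, _, σ, .sup s φ => .sup s (φ.subst (liftSubst s σ))
  | _, _, _, _, σ, .inf s φ => .inf s (φ.subst (liftSubst s σ))

theorem BasicFormula.eval_subst {n m : ℕ} {Γ : Fin n → L.Sorts} {Δ : Fin m → L.Sorts}
    (σ : ∀ i, Term Δ (Γ i)) (φ : BasicFormula Γ) (M : Structure.{u, w} L) (a : M.Tuple Δ) :
    (φ.subst σ).eval M a = φ.eval M fun i => (σ i).eval M a := by
  induction φ generalizing m with
  | rel R ts => simp only [BasicFormula.subst, BasicFormula.eval, Term.eval_subst]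
  | dist t₁ t₂ => simp only [BasicFormula.subst, BasicFormula.eval, Term.eval_subst]
  | conn f φ ih => simp only [BasicFormula.subst, BasicFormula.eval, ih]
  | sup s φ ih => simp only [BasicFormula.subst, BasicFormula.eval, ih, eval_liftSubst]
  | inf s φ ih => simp only [BasicFormula.subst, BasicFormula.eval, ih, eval_liftSubst]

/-! ### Real functions of assignments that are given by basic formulas -/

/-- Assignments in `M` of values to named variables, where the variable `v` has sort `srt v`. -/
abbrev Structure.Assignment (M : Structure.{u, w} L) {V : Type*} (srt : V → L.Sorts) :=
  ∀ v, M.Carrier (srt v)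

/-- The function `g` of a structure and an assignment is the value of a basic formula whose
variables are in the set `F`. -/
def IsFormulaValue {V : Type*} (srt : V → L.Sorts) (F : Set V)
    (g : ∀ M : Structure.{u, w} L, M.Assignment srt → ℝ) : Prop :=
  ∃ (n : ℕ) (e : Fin n → V), (∀ i, e i ∈ F) ∧ ∃ φ : BasicFormula (fun i => srt (e i)),
    ∀ M c, g M c = φ.eval M (fun i => c (e i))

variable {V : Type*} {srt : V → L.Sorts}

theorem _root_.Set.Finite.exists_range_eq {α : Type*} {s : Set α} (h : s.Finite) :
    ∃ (m : ℕ) (e : Fin m → α), Set.range e = s := by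
  obtain ⟨m, e, -, he⟩ := h.fin_param
  exact ⟨m, e, he⟩

/-- The transport `h ▸` allows a variable whose sort is known only up to a propositional equality,
as for variables listed by an arbitrary enumeration. -/
theorem exists_term_eval_eq {m : ℕ} {e : Fin m → V} {j : Fin m} {v : V} {s : L.Sorts}
    (hj : e j = v) (h : srt v = s) :
    ∃ t : Term (fun j => srt (e j)) s, ∀ (M : Structure.{u, w} L) (c : M.Assignment srt),
      t.eval M (fun j => c (e j)) = h ▸ c v := by
  subst hj
  subst h
  exact ⟨.var (Γ := fun j => srt (e j)) j, fun M c => rfl⟩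

theorem BasicFormula.exists_eval_eq_of_range_subset {n m : ℕ} {e : Fin n → V} {e' : Fin m → V}
    (h : ∀ i, ∃ j, e' j = e i) (φ : BasicFormula (fun i => srt (e i))) :
    ∃ ψ : BasicFormula (fun j => srt (e' j)), ∀ (M : Structure.{u, w} L) (c : M.Assignment srt),
      ψ.eval M (fun j => c (e' j)) = φ.eval M (fun i => c (e i)) := by
  choose j hj using h
  choose t ht using fun i => exists_term_eval_eq.{u, w} (srt := srt) (hj i) rfl
  exact ⟨φ.subst t, fun M c => by simp only [BasicFormula.eval_subst, ht]⟩

namespace IsFormulaValue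

variable {F : Set V} {g : ∀ M : Structure.{u, w} L, M.Assignment srt → ℝ}

theorem mono {F' : Set V} (hg : IsFormulaValue srt F g) (h : F ⊆ F') :
    IsFormulaValue srt F' g := by
  obtain ⟨n, e, he, φ, hφ⟩ := hg
  exact ⟨n, e, fun i => h (he i), φ, hφ⟩

theorem exists_formula {m : ℕ} {e : Fin m → V} (hg : IsFormulaValue srt F g)
    (h : F ⊆ Set.range e) : ∃ φ : BasicFormula (fun i => srt (e i)),
      ∀ M c, g M c = φ.eval M (fun i => c (e i)) := by
  obtain ⟨n, e', he, φ, hφ⟩ := hg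
  obtain ⟨ψ, hψ⟩ := φ.exists_eval_eq_of_range_subset (fun i => h (he i))
  exact ⟨ψ, fun M c => by rw [hψ, hφ]⟩

theorem of_eval {m : ℕ} (e : Fin m → V) (φ : BasicFormula (fun i => srt (e i))) :
    IsFormulaValue.{u, w} srt (Set.range e) fun M c => φ.eval M (fun i => c (e i)) :=
  ⟨m, e, fun i => ⟨i, rfl⟩, φ, fun _ _ => rfl⟩

theorem congr (hg : IsFormulaValue srt F g) {M : Structure.{u, w} L} {c c' : M.Assignment srt}
    (h : ∀ v ∈ F, c v = c' v) : g M c = g M c' := by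
  obtain ⟨n, e, he, φ, hφ⟩ := hg
  rw [hφ, hφ]
  congr 1
  funext i
  exact h _ (he i)

theorem exists_finite (hg : IsFormulaValue srt F g) :
    ∃ F' : Set V, F'.Finite ∧ F' ⊆ F ∧ IsFormulaValue srt F' g := by
  obtain ⟨n, e, he, φ, hφ⟩ := hg
  exact ⟨Set.range e, Set.finite_range e, by rintro _ ⟨i, rfl⟩; exact he i,
    n, e, fun i => ⟨i, rfl⟩, φ, hφ⟩

theorem conn {k : ℕ} {G : Fin k → ∀ M : Structure.{u, w} L, M.Assignment srt → ℝ}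
    (hG : ∀ i, IsFormulaValue srt F (G i)) {f : (Fin k → ℝ) → ℝ} (hf : Continuous f) :
    IsFormulaValue srt F fun M c => f fun i => G i M c := by
  choose F' hfin hF' hG' using fun i => (hG i).exists_finite
  obtain ⟨m, e, he⟩ := (Set.finite_iUnion hfin).exists_range_eq
  choose φ hφ using fun i => (hG' i).exists_formula (e := e)
    (he ▸ Set.subset_iUnion F' i)
  refine ⟨m, e, fun i => ?_, .conn ⟨f, hf⟩ φ, fun M c => ?_⟩
  · obtain ⟨j, hj⟩ := Set.mem_iUnion.1 (he ▸ Set.mem_range_self i : e i ∈ ⋃ i, F' i)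
    exact hF' j hj
  · simp only [BasicFormula.eval, hφ, ContinuousMap.coe_mk]

theorem const (r : ℝ) : IsFormulaValue.{u, w} srt F fun _ _ => r :=
  conn (k := 0) (G := fun i => i.elim0) (fun i => i.elim0) (f := fun _ => r) continuous_const

theorem comp (hg : IsFormulaValue srt F g) {f : ℝ → ℝ} (hf : Continuous f) :
    IsFormulaValue srt F fun M c => f (g M c) :=
  conn (k := 1) (G := fun _ => g) (fun _ => hg) (f := fun x => f (x 0)) (by fun_prop)

theorem comp₂ {g' : ∀ M : Structure.{u, w} L, M.Assignment srt → ℝ}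
    (hg : IsFormulaValue srt F g) (hg' : IsFormulaValue srt F g') {f : ℝ × ℝ → ℝ}
    (hf : Continuous f) : IsFormulaValue srt F fun M c => f (g M c, g' M c) :=
  conn (k := 2) (G := ![g, g']) (fun i => by fin_cases i <;> assumption)
    (f := fun x => f (x 0, x 1)) (by fun_prop)

theorem sum {ι : Type*} {G : ι → ∀ M : Structure.{u, w} L, M.Assignment srt → ℝ} (I : Finset ι)
    (hG : ∀ i ∈ I, IsFormulaValue srt F (G i)) :
    IsFormulaValue srt F fun M c => ∑ i ∈ I, G i M c := by
  classical
  induction I using Finset.induction_on with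
  | empty => simpa using const 0
  | insert i I hi ih =>
    simp only [Finset.sum_insert hi]
    exact comp₂ (hG i (Finset.mem_insert_self i I))
      (ih fun j hj => hG j (Finset.mem_insert_of_mem hj)) (f := fun x => x.1 + x.2) (by fun_prop)

theorem dist {v v' : V} {s : L.Sorts} (hv : v ∈ F) (hv' : v' ∈ F) (h : srt v = s)
    (h' : srt v' = s) :
    IsFormulaValue.{u, w} srt F fun M c => Dist.dist (h ▸ c v : M.Carrier s) (h' ▸ c v') := by
  obtain ⟨t, ht⟩ := exists_term_eval_eq.{u, w} (e := ![v, v']) (j := 0) rfl h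
  obtain ⟨t', ht'⟩ := exists_term_eval_eq.{u, w} (e := ![v, v']) (j := 1) rfl h'
  refine ⟨2, ![v, v'], fun i => by fin_cases i <;> assumption, .dist t t', fun M c => ?_⟩
  simp only [BasicFormula.eval, ht, ht']
  rfl

-- The variable `v` becomes the bound variable of an `inf`; the other variables of the formula are
-- enumerated afresh. Should `v` itself belong to `F`, its occurrences in `g` are nevertheless
-- bound, and at most a dummy free variable remains.
open Classical in
theorem iInf {v : V} (hg : IsFormulaValue srt (insert v F) g) :
    IsFormulaValue srt F fun M c => ⨅ y, g M (Function.update c v y) := by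
  obtain ⟨n, e, he, φ, hφ⟩ := hg
  obtain ⟨m, e', he'⟩ := ((Set.finite_range e).inter_of_left F).exists_range_eq
  have key : ∀ i, ∃ t : Term (consSort (srt v) fun j => srt (e' j)) (srt (e i)),
      ∀ (M : Structure.{u, w} L) (c : M.Assignment srt) (y : M.Carrier (srt v)),
        t.eval M (M.cons y fun j => c (e' j)) = Function.update c v y (e i) := by
    intro i
    by_cases hi : e i = v
    · rw [hi]
      exact ⟨Term.varZero _, fun M c y => by rw [Function.update_self]; rfl⟩
    · obtain ⟨j, hj⟩ : e i ∈ Set.range e' := he' ▸ ⟨⟨i, rfl⟩, (he i).resolve_left hi⟩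
      refine ⟨hj ▸ Term.varSucc _ j, fun M c y => ?_⟩
      rw [Function.update_of_ne hi]
      generalize e i = z at hj
      subst hj
      rfl
  choose t ht using key
  refine ⟨m, e', fun j => ?_, .inf (srt v) (φ.subst t), fun M c => ?_⟩
  · exact (he' ▸ Set.mem_range_self j : e' j ∈ Set.range e ∩ F).2
  · simp only [BasicFormula.eval, BasicFormula.eval_subst, ht, hφ]

theorem bddBelow (hg : IsFormulaValue srt F g) {ι : Type*} (M : Structure.{u, w} L)
    (c : ι → M.Assignment srt) : BddBelow (Set.range fun i => g M (c i)) := by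
  obtain ⟨n, e, he, φ, hφ⟩ := hg
  obtain ⟨B, hB⟩ := φ.exists_bound
  refine ⟨-B, ?_⟩
  rintro _ ⟨i, rfl⟩
  simp only [hφ]
  exact (abs_le.1 (hB M _)).1

/-- The infimum over all values of finitely many variables is again given by a formula. -/
theorem exists_inf (Q : Finset V) (hg : IsFormulaValue srt (F ∪ Q) g) :
    ∃ G, IsFormulaValue srt F G ∧ ∀ (M : Structure.{u, w} L) (c : M.Assignment srt),
      (∀ c', (∀ v ∉ Q, c' v = c v) → G M c ≤ g M c') ∧
      ∀ r, G M c < r → ∃ c', (∀ v ∉ Q, c' v = c v) ∧ g M c' < r := by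
  classical
  induction Q using Finset.induction_on generalizing F with
  | empty =>
    refine ⟨g, by simpa using hg, fun M c => ⟨fun c' h => ?_, fun r hr => ⟨c, by simp, hr⟩⟩⟩
    rw [show c' = c from funext fun v => h v (by simp)]
  | insert q Q hq ih =>
    -- The variables in `Q` are eliminated while `q` is still counted among the free ones; `q` is
    -- eliminated last.
    obtain ⟨G, hG, h⟩ := ih (F := insert q F) (hg.mono (by
      intro v; simp only [Finset.coe_insert, Set.mem_union, Set.mem_insert_iff]; tauto))
    refine ⟨_, hG.iInf, fun M c => ⟨fun c' hc' => ?_, fun r hr => ?_⟩⟩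
    · refine (ciInf_le (hG.bddBelow M fun y => Function.update c q y) (c' q)).trans
        ((h M _).1 c' fun v hv => ?_)
      by_cases hvq : v = q
      · subst hvq; rw [Function.update_self]
      · rw [Function.update_of_ne hvq]
        exact hc' v (by simp [hvq, hv])
    · obtain ⟨y, hy⟩ := exists_lt_of_ciInf_lt hr
      obtain ⟨c', hc', hr'⟩ := (h M _).2 r hy
      refine ⟨c', fun v hv => ?_, hr'⟩
      rw [Finset.mem_insert, not_or] at hv
      rw [hc' v hv.2, Function.update_of_ne hv.1]

end IsFormulaValue

end MetricLanguage

/-! ### Limits of bounded real functions along ultrafilters -/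

/-- The limit of a real function along an ultrafilter. -/
noncomputable def ultraLim {α : Type*} (U : Ultrafilter α) (f : α → ℝ) : ℝ :=
  limUnder (U : Filter α) f

/-- Boundedness places the image ultrafilter in a compact interval, where it converges; without
convergence `ultraLim` has no meaning. -/
theorem tendsto_ultraLim {α : Type*} (U : Ultrafilter α) {f : α → ℝ} {B : ℝ}
    (hB : ∀ a, |f a| ≤ B) : Tendsto f U (𝓝 (ultraLim U f)) := by
  have h : ((U.map f : Ultrafilter ℝ) : Filter ℝ) ≤ 𝓟 (Set.Icc (-B) B) :=
    tendsto_principal.2 (Eventually.of_forall fun a => abs_le.1 (hB a))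
  obtain ⟨x, -, hx⟩ := isCompact_Icc.ultrafilter_le_nhds _ h
  exact tendsto_nhds_limUnder ⟨x, hx⟩

theorem ultraLim_eq {α : Type*} {U : Ultrafilter α} {f : α → ℝ} {x : ℝ}
    (h : Tendsto f U (𝓝 x)) : ultraLim U f = x :=
  h.limUnder_eq

namespace MetricLanguage

variable {L : MetricLanguage.{u}}

/-! ### Ultraproducts of sequences of structures -/

/-- Sequences of elements of sort `s` of the structures `M n`, as a pseudometric space for the
limit along `U` of the distances. -/
def UltraSeq (M : ℕ → Structure.{u, w} L) (_U : Ultrafilter ℕ) (s : L.Sorts) : Type w :=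
  ∀ n, (M n).Carrier s

namespace UltraSeq

variable (M : ℕ → Structure.{u, w} L) (U : Ultrafilter ℕ)

theorem tendsto_dist {s : L.Sorts} (g h : UltraSeq M U s) :
    Tendsto (fun n => dist (g n) (h n)) U (𝓝 (ultraLim U fun n => dist (g n) (h n))) :=
  tendsto_ultraLim U (B := L.sortBound s) fun n => by
    rw [abs_of_nonneg dist_nonneg]
    exact (M n).dist_le s _ _

noncomputable instance (s : L.Sorts) : PseudoMetricSpace (UltraSeq M U s) where
  dist g h := ultraLim U fun n => dist (g n) (h n)
  dist_self g := ultraLim_eq (by simp)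
  dist_comm g h := by simp only [_root_.dist_comm]
  dist_triangle g h k := le_of_tendsto_of_tendsto' (tendsto_dist M U g k)
    ((tendsto_dist M U g h).add (tendsto_dist M U h k)) fun n => _root_.dist_triangle _ _ _

variable {M U}

theorem tendsto_dist' {s : L.Sorts} (g h : UltraSeq M U s) :
    Tendsto (fun n => dist (g n) (h n)) U (𝓝 (dist g h)) :=
  tendsto_dist M U g h

theorem dist_le_of_eventually {s : L.Sorts} {g h : UltraSeq M U s} {r : ℝ}
    (H : ∀ᶠ n in (U : Filter ℕ), dist (g n) (h n) ≤ r) : dist g h ≤ r :=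
  le_of_tendsto (tendsto_dist' g h) H

theorem eventually_dist_lt {s : L.Sorts} {g h : UltraSeq M U s} {r : ℝ} (H : dist g h < r) :
    ∀ᶠ n in (U : Filter ℕ), dist (g n) (h n) < r :=
  (tendsto_dist' g h).eventually_lt_const H

/-- In a complete space, every sequence has an approximate limit, which is as close to a term as
the geometric decay of the distances up to a later term provides. -/
theorem _root_.exists_dist_le_of_geometric {X : Type*} [MetricSpace X] [CompleteSpace X]
    (u : ℕ → X) : ∃ y, ∀ n, (∀ j < n, dist (u j) (u (j + 1)) ≤ 2 / 2 / 2 ^ j) →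
      dist (u n) y ≤ 2 / 2 ^ n := by
  classical
  -- `v` follows `u` but refuses every step that is too long. It is thus always Cauchy, and it
  -- agrees with `u` as long as `u` obeys the decay.
  let v : ℕ → X := fun n => Nat.rec (u 0)
    (fun j x => if dist x (u (j + 1)) ≤ 2 / 2 / 2 ^ j then u (j + 1) else x) n
  have hv : ∀ j, v (j + 1) = if dist (v j) (u (j + 1)) ≤ 2 / 2 / 2 ^ j then u (j + 1) else v j :=
    fun j => rfl
  have hd : ∀ j, dist (v j) (v (j + 1)) ≤ 2 / 2 / 2 ^ j := by
    intro j
    rw [hv]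
    split_ifs with h
    · exact h
    · rw [dist_self]; positivity
  obtain ⟨y, hy⟩ := cauchySeq_tendsto_of_complete (cauchySeq_of_le_geometric_two hd)
  refine ⟨y, fun n hn => ?_⟩
  have hvu : ∀ m ≤ n, v m = u m := by
    intro m
    induction m with
    | zero => exact fun _ => rfl
    | succ m ih =>
      intro hm
      rw [hv, ih (by omega), if_pos (hn m (by omega))]
  rw [← hvu n le_rfl]
  exact dist_le_of_le_geometric_two_of_tendsto hd hy n

/-- For a rapidly Cauchy sequence of sequences, the approximate limits taken in each factor form a
limit: for each `n`, almost all factors see the first `n` steps obey the decay. No assumption on `U`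
is needed. -/
instance (s : L.Sorts) : CompleteSpace (UltraSeq M U s) := by
  refine Metric.complete_of_convergent_controlled_sequences (fun n => 2 / 2 / 2 ^ n)
    (fun n => by positivity) fun u hu => ?_
  choose y hy using fun i => exists_dist_le_of_geometric (fun n => u n i)
  have key : ∀ n, dist (u n) (y : UltraSeq M U s) ≤ 2 / 2 ^ n := by
    intro n
    apply dist_le_of_eventually
    have : ∀ᶠ i in (U : Filter ℕ), ∀ j ∈ Finset.range n,
        dist (u j i) (u (j + 1) i) < 2 / 2 / 2 ^ j :=
      (Finset.eventually_all _).2 fun j _ =>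
        eventually_dist_lt (hu j j (j + 1) le_rfl (Nat.le_succ j))
    filter_upwards [this] with i hi
    exact hy i n fun j hj => (hi j (Finset.mem_range.2 hj)).le
  refine ⟨y, tendsto_iff_dist_tendsto_zero.2 (squeeze_zero (fun _ => dist_nonneg) key ?_)⟩
  have := (tendsto_pow_atTop_nhds_zero_of_lt_one (r := (1 / 2 : ℝ)) (by norm_num)
    (by norm_num)).const_mul 2
  simpa [div_eq_mul_inv] using this

end UltraSeq

section Ultraproduct

variable (M : ℕ → Structure.{u, w} L) (U : Ultrafilter ℕ)

/-- A function symbol applied to sequences, term by term. -/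
def UltraSeq.funMap (f : L.Func) (a : ∀ i, UltraSeq M U (L.funDom f i)) :
    UltraSeq M U (L.funCod f) :=
  fun n => (M n).funMap f fun i => a i n

theorem UltraSeq.dist_funMap_le (f : L.Func) {e : unitInterval} (he : 0 < e)
    (a b : ∀ i, UltraSeq M U (L.funDom f i))
    (h : ∀ i, dist (a i) (b i) < ((L.funMod f).toFun e : ℝ)) :
    dist (UltraSeq.funMap M U f a) (UltraSeq.funMap M U f b) ≤ (e : ℝ) := by
  apply UltraSeq.dist_le_of_eventually
  filter_upwards [eventually_all.2 fun i => UltraSeq.eventually_dist_lt (h i)] with n hn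
  exact (M n).funMap_uc f e he _ _ hn

theorem UltraSeq.tendsto_relMap (R : L.Rel) (a : ∀ i, UltraSeq M U (L.relDom R i)) :
    Tendsto (fun n => (M n).relMap R fun i => a i n) U
      (𝓝 (ultraLim U fun n => (M n).relMap R fun i => a i n)) :=
  tendsto_ultraLim U fun n => (M n).relMap_bound R _

theorem UltraSeq.abs_relMap_sub_le (R : L.Rel) {e : unitInterval} (he : 0 < e)
    (a b : ∀ i, UltraSeq M U (L.relDom R i))
    (h : ∀ i, dist (a i) (b i) < ((L.relMod R).toFun e : ℝ)) :
    |ultraLim U (fun n => (M n).relMap R fun i => a i n) -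
      ultraLim U (fun n => (M n).relMap R fun i => b i n)| ≤ (e : ℝ) := by
  refine le_of_tendsto ((tendsto_relMap M U R a).sub (tendsto_relMap M U R b)).abs ?_
  filter_upwards [eventually_all.2 fun i => UltraSeq.eventually_dist_lt (h i)] with n hn
  exact (M n).relMap_uc R e he _ _ hn

/-- A representing sequence of an element of the ultraproduct. -/
noncomputable def UltraSeq.rep {s : L.Sorts} (q : SeparationQuotient (UltraSeq M U s)) :
    UltraSeq M U s :=
  Function.surjInv SeparationQuotient.surjective_mk q

@[simp] theorem UltraSeq.mk_rep {s : L.Sorts} (q : SeparationQuotient (UltraSeq M U s)) :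
    SeparationQuotient.mk (UltraSeq.rep M U q) = q :=
  Function.surjInv_eq _ q

theorem UltraSeq.dist_rep {s : L.Sorts} (q q' : SeparationQuotient (UltraSeq M U s)) :
    dist (rep M U q) (rep M U q') = dist q q' := by
  rw [← SeparationQuotient.dist_mk, mk_rep, mk_rep]

theorem UltraSeq.dist_rep_mk {s : L.Sorts} (g : UltraSeq M U s) :
    dist (rep M U (SeparationQuotient.mk g)) g = 0 := by
  rw [← SeparationQuotient.dist_mk, mk_rep, dist_self]

/-- The metric ultraproduct of a sequence of structures. -/
noncomputable def ultraproduct : Structure.{u, w} L where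
  Carrier s := SeparationQuotient (UltraSeq M U s)
  nonempty s :=
    ⟨SeparationQuotient.mk (X := UltraSeq M U s) fun n => ((M n).nonempty s).some⟩
  dist_le s a b := by
    rw [← UltraSeq.dist_rep]
    exact UltraSeq.dist_le_of_eventually (Eventually.of_forall fun n => (M n).dist_le s _ _)
  funMap f a := SeparationQuotient.mk (UltraSeq.funMap M U f fun i => UltraSeq.rep M U (a i))
  funMap_uc f e he a b h := by
    rw [SeparationQuotient.dist_mk]
    refine UltraSeq.dist_funMap_le M U f he (fun i => UltraSeq.rep M U (a i)) _ fun i => ?_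
    rw [UltraSeq.dist_rep]
    exact h i
  relMap R a := ultraLim U fun n => (M n).relMap R fun i => UltraSeq.rep M U (a i) n
  relMap_bound R a := by
    exact le_of_tendsto (UltraSeq.tendsto_relMap M U R fun i => UltraSeq.rep M U (a i)).abs
      (Eventually.of_forall fun n => (M n).relMap_bound R _)
  relMap_uc R e he a b h := by
    refine UltraSeq.abs_relMap_sub_le M U R he (fun i => UltraSeq.rep M U (a i)) _ fun i => ?_
    rw [UltraSeq.dist_rep]
    exact h i

/-- The element of the ultraproduct given by a sequence. -/
noncomputable def ultraMk {s : L.Sorts} (g : ∀ n, (M n).Carrier s) : (ultraproduct M U).Carrier s :=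
  SeparationQuotient.mk (X := UltraSeq M U s) g

theorem ultraMk_surjective (s : L.Sorts) : Function.Surjective (ultraMk M U (s := s)) :=
  SeparationQuotient.surjective_mk (X := UltraSeq M U s)

theorem eq_zero_of_le_unitInterval {r : ℝ} (h0 : 0 ≤ r)
    (h : ∀ e : unitInterval, 0 < e → r ≤ e) : r = 0 := by
  refine le_antisymm (le_of_forall_pos_le_add fun ε hε => ?_) h0
  obtain ⟨e, he, heε⟩ := exists_unitInterval_lt hε
  linarith [h e he]

/-- Symbols are interpreted through chosen representatives. Any other representatives are at
distance `0`, which is below every value of the modulus, so the result is the same. -/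
theorem ultraproduct_funMap (f : L.Func) (a : ∀ i n, (M n).Carrier (L.funDom f i)) :
    (ultraproduct M U).funMap f (fun i => ultraMk M U (a i)) =
      ultraMk M U fun n => (M n).funMap f fun i => a i n := by
  refine (SeparationQuotient.mk_eq_mk (X := UltraSeq M U (L.funCod f))).2
    (Metric.inseparable_iff.2 ?_)
  refine eq_zero_of_le_unitInterval dist_nonneg fun e he => ?_
  exact UltraSeq.dist_funMap_le M U f he _ a fun i =>
    (UltraSeq.dist_rep_mk M U (a i)).trans_lt ((L.funMod f).coe_pos he)

theorem ultraproduct_relMap (R : L.Rel) (a : ∀ i n, (M n).Carrier (L.relDom R i)) :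
    (ultraproduct M U).relMap R (fun i => ultraMk M U (a i)) =
      ultraLim U fun n => (M n).relMap R fun i => a i n := by
  refine sub_eq_zero.1 (abs_eq_zero.1 (eq_zero_of_le_unitInterval (abs_nonneg _) fun e he => ?_))
  exact UltraSeq.abs_relMap_sub_le M U R he _ a fun i =>
    (UltraSeq.dist_rep_mk M U (a i)).trans_lt ((L.relMod R).coe_pos he)

theorem ultraproduct_eval_term {n : ℕ} {Γ : Fin n → L.Sorts} {s : L.Sorts} (t : Term Γ s)
    (a : ∀ i k, (M k).Carrier (Γ i)) :
    t.eval (ultraproduct M U) (fun i => ultraMk M U (a i)) =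
      ultraMk M U fun k => t.eval (M k) fun i => a i k := by
  induction t with
  | var i => rfl
  | func f ts ih => simp only [Term.eval, ih, ultraproduct_funMap]

theorem ultraproduct_cons {n : ℕ} {Γ : Fin n → L.Sorts} {s : L.Sorts}
    (b : ∀ k, (M k).Carrier s) (a : ∀ i k, (M k).Carrier (Γ i)) :
    (ultraproduct M U).cons (ultraMk M U b) (fun i => ultraMk M U (a i)) =
      fun i => ultraMk M U fun k => (M k).cons (b k) (fun i => a i k) i := by
  funext i
  refine Fin.cases ?_ (fun i => ?_) i <;> rfl

theorem BasicFormula.tendsto_ultraLim {n : ℕ} {Γ : Fin n → L.Sorts} (φ : BasicFormula Γ)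
    (a : ∀ k, (M k).Tuple Γ) : Tendsto (fun k => φ.eval (M k) (a k)) U
      (𝓝 (ultraLim U fun k => φ.eval (M k) (a k))) := by
  obtain ⟨B, hB⟩ := φ.exists_bound
  exact _root_.tendsto_ultraLim U fun k => hB (M k) (a k)

/-- **Łoś's theorem** for metric ultraproducts. -/
theorem tendsto_eval_ultraproduct {n : ℕ} {Γ : Fin n → L.Sorts} (φ : BasicFormula Γ)
    (a : ∀ i k, (M k).Carrier (Γ i)) :
    Tendsto (fun k => φ.eval (M k) fun i => a i k) U
      (𝓝 (φ.eval (ultraproduct M U) fun i => ultraMk M U (a i))) := by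
  induction φ with
  | rel R ts =>
    simp only [BasicFormula.eval, ultraproduct_eval_term, ultraproduct_relMap]
    exact UltraSeq.tendsto_relMap M U R _
  | dist t₁ t₂ =>
    simp only [BasicFormula.eval, ultraproduct_eval_term]
    exact UltraSeq.tendsto_dist' (M := M) (U := U) _ _
  | conn f φ ih =>
    simp only [BasicFormula.eval]
    exact (f.continuous.tendsto _).comp (tendsto_pi_nhds.2 fun i => ih i a)
  | @sup n Γ s φ ih =>
    have hl := (BasicFormula.sup s φ).tendsto_ultraLim M U fun k i => a i k
    suffices H : ultraLim U (fun k => (BasicFormula.sup s φ).eval (M k) fun i => a i k) =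
        (BasicFormula.sup s φ).eval (ultraproduct M U) fun i => ultraMk M U (a i) from H ▸ hl
    have hcons : ∀ b : ∀ k, (M k).Carrier s,
        Tendsto (fun k => φ.eval (M k) ((M k).cons (b k) fun i => a i k)) U
          (𝓝 (φ.eval (ultraproduct M U)
            ((ultraproduct M U).cons (ultraMk M U b) fun i => ultraMk M U (a i)))) := by
      intro b
      rw [ultraproduct_cons]
      exact ih fun i k => (M k).cons (b k) (fun i => a i k) i
    apply le_antisymm
    · refine le_of_forall_pos_le_add fun ε hε => ?_
      -- Near-maximizers chosen in the factors together form one element of the ultraproduct.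
      have hex : ∀ k, ∃ b : (M k).Carrier s, (BasicFormula.sup s φ).eval (M k) (fun i => a i k) - ε
          < φ.eval (M k) ((M k).cons b fun i => a i k) :=
        fun k => exists_lt_of_lt_ciSup (sub_lt_self _ hε)
      choose b hb using hex
      have h₁ := le_of_tendsto_of_tendsto' hl ((hcons b).add_const ε) fun k => by
        linarith [hb k]
      refine h₁.trans (add_le_add_left ?_ ε)
      exact φ.le_eval_sup _ _ _
    · refine ciSup_le fun b => ?_
      obtain ⟨b, rfl⟩ := ultraMk_surjective M U s b
      exact le_of_tendsto_of_tendsto' (hcons b) hl fun k => φ.le_eval_sup _ _ _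
  | @inf n Γ s φ ih =>
    have hl := (BasicFormula.inf s φ).tendsto_ultraLim M U fun k i => a i k
    suffices H : ultraLim U (fun k => (BasicFormula.inf s φ).eval (M k) fun i => a i k) =
        (BasicFormula.inf s φ).eval (ultraproduct M U) fun i => ultraMk M U (a i) from H ▸ hl
    have hcons : ∀ b : ∀ k, (M k).Carrier s,
        Tendsto (fun k => φ.eval (M k) ((M k).cons (b k) fun i => a i k)) U
          (𝓝 (φ.eval (ultraproduct M U)
            ((ultraproduct M U).cons (ultraMk M U b) fun i => ultraMk M U (a i)))) := by
      intro b
      rw [ultraproduct_cons]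
      exact ih fun i k => (M k).cons (b k) (fun i => a i k) i
    apply le_antisymm
    · refine le_ciInf fun b => ?_
      obtain ⟨b, rfl⟩ := ultraMk_surjective M U s b
      exact le_of_tendsto_of_tendsto' hl (hcons b) fun k => φ.eval_inf_le _ _ _
    · refine le_of_forall_pos_le_add fun ε hε => ?_
      have hex : ∀ k, ∃ b : (M k).Carrier s, φ.eval (M k) ((M k).cons b fun i => a i k) <
          (BasicFormula.inf s φ).eval (M k) (fun i => a i k) + ε :=
        fun k => exists_lt_of_ciInf_lt (lt_add_of_pos_right _ hε)
      choose b hb using hex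
      refine le_trans ?_ (le_of_tendsto_of_tendsto' (hcons b) (hl.add_const ε) fun k => (hb k).le)
      exact φ.eval_inf_le _ _ _

theorem ultraproduct_models {T : Set L.Sentence} (h : ∀ n, (M n).Models T) :
    (ultraproduct M U).Models T := by
  intro σ hσ
  have key := tendsto_eval_ultraproduct M U σ fun i => i.elim0
  have h₀ : ∀ n, σ.eval (M n) (fun i => i.elim0) = 0 := fun n => h n σ hσ
  rw [Subsingleton.elim (fun i : Fin 0 => ultraMk M U (s := (Fin.elim0 i : L.Sorts)) i.elim0)
    fun i => i.elim0] at key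
  refine tendsto_nhds_unique key (tendsto_const_nhds.congr fun n => ?_)
  rw [← h₀ n]
  congr 1
  funext i
  exact i.elim0

end Ultraproduct

/-! ### Henkin constants and the elementary substructure they generate. -/

/-- Names for constants: countably many of each sort. -/
abbrev Constant (L : MetricLanguage.{u}) : Type u := Σ _ : L.Sorts, ℕ

/-- The sort of a constant. -/
abbrev constSort (q : L.Constant) : L.Sorts := q.1

/-- Interpretations of all constants in `M`. -/
abbrev Structure.Constants (M : Structure.{u, w} L) := M.Assignment (constSort (L := L))

/-- The constants with the given sorts and numbers. -/
abbrev mkConst {n : ℕ} (Γ : Fin n → L.Sorts) (e : Fin n → ℕ) (i : Fin n) : L.Constant := ⟨Γ i, e i⟩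

/-- Suprema over a new variable are approximately attained at constants. -/
def Structure.Henkin (M : Structure.{u, w} L) (c : M.Constants) : Prop :=
  ∀ (n : ℕ) (Γ : Fin n → L.Sorts) (e : Fin n → ℕ) (s : L.Sorts) (φ : BasicFormula (consSort s Γ))
    (ε : ℝ), 0 < ε → ∃ k : ℕ, (BasicFormula.sup s φ).eval M (fun i => c (mkConst Γ e i)) ≤
      φ.eval M (M.cons (c ⟨s, k⟩) fun i => c (mkConst Γ e i)) + ε

/-- The negation of a formula. -/
def BasicFormula.neg {n : ℕ} {Γ : Fin n → L.Sorts} (φ : BasicFormula Γ) : BasicFormula Γ :=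
  .conn (k := 1) ⟨fun x => -x 0, by fun_prop⟩ fun _ => φ

@[simp] theorem BasicFormula.eval_neg {n : ℕ} {Γ : Fin n → L.Sorts} (φ : BasicFormula Γ)
    (M : Structure.{u, w} L) (a : M.Tuple Γ) : φ.neg.eval M a = -φ.eval M a := rfl

namespace Structure

variable {M : Structure.{u, w} L} {c : M.Constants}

theorem Henkin.exists_inf (hc : M.Henkin c) {n : ℕ} (Γ : Fin n → L.Sorts) (e : Fin n → ℕ)
    (s : L.Sorts) (φ : BasicFormula (consSort s Γ)) (ε : ℝ) (hε : 0 < ε) :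
    ∃ k : ℕ, φ.eval M (M.cons (c ⟨s, k⟩) fun i => c (mkConst Γ e i)) ≤
      (BasicFormula.inf s φ).eval M (fun i => c (mkConst Γ e i)) + ε := by
  obtain ⟨k, hk⟩ := hc _ Γ e s φ.neg ε hε
  refine ⟨k, ?_⟩
  have : -(BasicFormula.sup s φ.neg).eval M (fun i => c (mkConst Γ e i)) ≤
      (BasicFormula.inf s φ).eval M (fun i => c (mkConst Γ e i)) :=
    le_ciInf fun b => by
      have := φ.neg.le_eval_sup M (fun i => c (mkConst Γ e i)) b
      rw [BasicFormula.eval_neg] at this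
      linarith
  rw [BasicFormula.eval_neg] at hk
  linarith

/-- The closure of the set of values of the constants of sort `s`. -/
def constClosure (M : Structure.{u, w} L) (c : M.Constants) (s : L.Sorts) :
    Set (M.Carrier s) :=
  closure (Set.range fun k : ℕ => c ⟨s, k⟩)

theorem const_mem_constClosure (s : L.Sorts) (k : ℕ) : c ⟨s, k⟩ ∈ M.constClosure c s :=
  subset_closure ⟨k, rfl⟩

theorem exists_const_near {n : ℕ} {Γ : Fin n → L.Sorts} (a : M.Tuple Γ)
    (ha : ∀ i, a i ∈ M.constClosure c (Γ i)) {δ : ℝ} (hδ : 0 < δ) :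
    ∃ e : Fin n → ℕ, ∀ i, dist (a i) (c (mkConst Γ e i)) < δ := by
  have : ∀ i, ∃ k : ℕ, dist (a i) (c ⟨Γ i, k⟩) < δ := fun i => by
    obtain ⟨_, ⟨k, rfl⟩, hk⟩ := Metric.mem_closure_iff.1 (ha i) δ hδ
    exact ⟨k, hk⟩
  choose e he using this
  exact ⟨e, he⟩

/-- At constants `c`, the formula `inf_y d(f(c), y)` has value `0`, witnessed by `f(c)` itself, so
the Henkin property yields a constant close to `f(c)`. -/
theorem Henkin.funMap_mem (hc : M.Henkin c) (f : L.Func) (a : ∀ i, M.Carrier (L.funDom f i))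
    (ha : ∀ i, a i ∈ M.constClosure c (L.funDom f i)) :
    M.funMap f a ∈ M.constClosure c (L.funCod f) := by
  refine Metric.mem_closure_iff.2 fun ε hε => ?_
  obtain ⟨u, hu, huε⟩ := exists_unitInterval_lt (half_pos hε)
  obtain ⟨e, he⟩ := exists_const_near a ha ((L.funMod f).coe_pos hu)
  obtain ⟨k, hk⟩ := hc.exists_inf _ e (L.funCod f)
    (.dist (.func f (Term.varSucc _)) (Term.varZero _)) (ε / 2) (half_pos hε)
  refine ⟨_, ⟨k, rfl⟩, ?_⟩
  have h₁ := M.funMap_uc f u hu _ _ he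
  have h₂ := hk.trans (add_le_add_left (BasicFormula.eval_inf_le _ M _
    (M.funMap f fun i => c (mkConst _ e i))) _)
  have h₃ : dist (M.funMap f fun i => c (mkConst _ e i)) (c ⟨L.funCod f, k⟩) ≤
      dist (M.funMap f fun i => c (mkConst _ e i)) (M.funMap f fun i => c (mkConst _ e i))
        + ε / 2 := h₂
  rw [dist_self] at h₃
  linarith [dist_triangle (M.funMap f a) (M.funMap f fun i => c (mkConst _ e i))
    (c ⟨L.funCod f, k⟩)]

/-- The substructure whose elements are the limits of constants. -/
def constSubstructure (M : Structure.{u, w} L) (c : M.Constants) (hc : M.Henkin c) :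
    Structure.{u, w} L where
  Carrier s := M.constClosure c s
  complete _ := isClosed_closure.completeSpace_coe
  nonempty s := ⟨⟨_, const_mem_constClosure s 0⟩⟩
  dist_le _ _ _ := M.dist_le _ _ _
  funMap f a := ⟨M.funMap f fun i => a i, hc.funMap_mem f _ fun i => (a i).2⟩
  funMap_uc f e he _ _ h := M.funMap_uc f e he _ _ h
  relMap R a := M.relMap R fun i => a i
  relMap_bound R _ := M.relMap_bound R _
  relMap_uc R e he _ _ h := M.relMap_uc R e he _ _ h

/-- The constants as elements of the substructure. -/
def constElem (hc : M.Henkin c) (s : L.Sorts) (k : ℕ) : (M.constSubstructure c hc).Carrier s :=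
  ⟨c ⟨s, k⟩, const_mem_constClosure s k⟩

/-- The inclusion of the substructure. -/
def inclusion (hc : M.Henkin c) {s : L.Sorts} (a : (M.constSubstructure c hc).Carrier s) :
    M.Carrier s :=
  Subtype.val a

theorem eval_term_constSubstructure (hc : M.Henkin c) {n : ℕ} {Γ : Fin n → L.Sorts} {s : L.Sorts}
    (t : Term Γ s) (a : (M.constSubstructure c hc).Tuple Γ) :
    inclusion hc (t.eval _ a) = t.eval M fun i => inclusion hc (a i) := by
  induction t with
  | var i => rfl
  | func f ts ih =>
    simp only [Term.eval, ← ih]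
    rfl

theorem inclusion_cons (hc : M.Henkin c) {n : ℕ} {Γ : Fin n → L.Sorts} {s : L.Sorts}
    (b : (M.constSubstructure c hc).Carrier s) (a : (M.constSubstructure c hc).Tuple Γ) :
    (fun i => inclusion hc ((M.constSubstructure c hc).cons b a i)) =
      M.cons (inclusion hc b) fun i => inclusion hc (a i) := by
  funext i
  refine Fin.cases ?_ (fun i => ?_) i <;> rfl

/-- The Tarski–Vaught test. -/
theorem eval_constSubstructure (hc : M.Henkin c) {n : ℕ} {Γ : Fin n → L.Sorts}
    (φ : BasicFormula Γ) (a : (M.constSubstructure c hc).Tuple Γ) :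
    φ.eval _ a = φ.eval M fun i => inclusion hc (a i) := by
  induction φ with
  | rel R ts =>
    simp only [BasicFormula.eval, ← eval_term_constSubstructure]
    rfl
  | dist t₁ t₂ =>
    simp only [BasicFormula.eval, ← eval_term_constSubstructure]
    rfl
  | conn f φ ih => simp only [BasicFormula.eval, ih]
  | @sup n Γ s φ ih =>
    apply le_antisymm
    · refine ciSup_le fun b => ?_
      rw [ih, inclusion_cons]
      exact φ.le_eval_sup M _ _
    · refine le_of_forall_pos_le_add fun ε hε => ?_
      obtain ⟨δ₁, h₁, H₁⟩ := (BasicFormula.sup s φ).uniformContinuous (ε / 3) (by positivity)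
      obtain ⟨δ₂, h₂, H₂⟩ := φ.uniformContinuous (ε / 3) (by positivity)
      -- The Henkin property speaks only of constant parameters: `a` is moved to constants, a
      -- witness is found there, and the parameters are moved back, each at a cost of `ε / 3`.
      obtain ⟨e, he⟩ := exists_const_near (fun i => inclusion hc (a i)) (fun i => (a i).2)
        (lt_min h₁ h₂)
      obtain ⟨k, hk⟩ := hc _ Γ e s φ (ε / 3) (by positivity)
      have A₁ := abs_lt.1 (H₁ M _ _ fun i => (he i).trans_le (min_le_left _ _))
      have A₂ := abs_lt.1 (H₂ M _ _ (M.dist_cons_lt (c ⟨s, k⟩) h₂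
        fun i => (he i).trans_le (min_le_right _ _)))
      have A₃ := φ.le_eval_sup (M.constSubstructure c hc) a (constElem hc s k)
      rw [ih, inclusion_cons] at A₃
      change φ.eval M (M.cons (c ⟨s, k⟩) _) ≤ _ at A₃
      linarith [A₁.2, A₂.1]
  | @inf n Γ s φ ih =>
    apply le_antisymm
    · refine le_of_forall_pos_le_add fun ε hε => ?_
      obtain ⟨δ₁, h₁, H₁⟩ := (BasicFormula.inf s φ).uniformContinuous (ε / 3) (by positivity)
      obtain ⟨δ₂, h₂, H₂⟩ := φ.uniformContinuous (ε / 3) (by positivity)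
      obtain ⟨e, he⟩ := exists_const_near (fun i => inclusion hc (a i)) (fun i => (a i).2)
        (lt_min h₁ h₂)
      obtain ⟨k, hk⟩ := hc.exists_inf Γ e s φ (ε / 3) (by positivity)
      have A₁ := abs_lt.1 (H₁ M _ _ fun i => (he i).trans_le (min_le_left _ _))
      have A₂ := abs_lt.1 (H₂ M _ _ (M.dist_cons_lt (c ⟨s, k⟩) h₂
        fun i => (he i).trans_le (min_le_right _ _)))
      have A₃ := φ.eval_inf_le (M.constSubstructure c hc) a (constElem hc s k)
      rw [ih, inclusion_cons] at A₃
      change _ ≤ φ.eval M (M.cons (c ⟨s, k⟩) _) at A₃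
      linarith [A₁.1, A₂.2]
    · refine le_ciInf fun b => ?_
      rw [ih, inclusion_cons]
      exact φ.eval_inf_le M _ _

theorem constSubstructure_models (hc : M.Henkin c) {T : Set L.Sentence} (h : M.Models T) :
    (M.constSubstructure c hc).Models T := by
  intro σ hσ
  rw [eval_constSubstructure, ← h σ hσ]
  congr 1
  funext i
  exact i.elim0

theorem constSubstructure_isSeparable (hc : M.Henkin c) :
    (M.constSubstructure c hc).IsSeparable := fun s => by
  have h : (Set.range (α := M.Carrier s) fun k : ℕ => c ⟨s, k⟩).Countable :=
    Set.countable_range (β := M.Carrier s) _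
  exact h.isSeparable.closure.separableSpace

end Structure

/-! ### Separable languages -/

/-- There is a countable set of formulas which approximates all formulas in the variables `Γ`,
uniformly in all structures. -/
def HasCountableApprox.{u', w'} {L : MetricLanguage.{u'}} {n : ℕ} (Γ : Fin n → L.Sorts) : Prop :=
  ∃ D : Set (BasicFormula Γ), D.Countable ∧ ∀ (φ : BasicFormula Γ) (ε : ℝ), 0 < ε →
    ∃ ψ ∈ D, ∀ (M : Structure.{u', w'} L) (a : M.Tuple Γ), |φ.eval M a - ψ.eval M a| ≤ ε

theorem exists_dense_mk_eq_densityChar (X : Type u) [TopologicalSpace X] :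
    ∃ D : Set X, Dense D ∧ Cardinal.mk D = densityChar X :=
  csInf_mem (s := {κ | ∃ D : Set X, Dense D ∧ Cardinal.mk D = κ})
    ⟨_, Set.univ, dense_univ, rfl⟩

theorem one_le_densityChar (X : Type u) [TopologicalSpace X] [Nonempty X] :
    1 ≤ densityChar X := by
  obtain ⟨D, hD, h⟩ := exists_dense_mk_eq_densityChar X
  rw [← h, Cardinal.one_le_iff_ne_zero, Cardinal.mk_ne_zero_iff]
  exact hD.nonempty.to_subtype

theorem separableSpace_of_densityChar_le (X : Type u) [TopologicalSpace X]
    (h : densityChar X ≤ Cardinal.aleph0) : TopologicalSpace.SeparableSpace X := by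
  obtain ⟨D, hD, h'⟩ := exists_dense_mk_eq_densityChar X
  exact ⟨D, Cardinal.le_aleph0_iff_set_countable.1 (h' ▸ h), hD⟩

instance (T : Set L.Sentence) {n : ℕ} (Γ : Fin n → L.Sorts) :
    Nonempty (TFormula.{u, w} T Γ) :=
  letI := formulaPseudoEMetric.{u, w} T Γ
  ⟨((BasicFormula.conn (k := 0) ⟨fun _ => 0, continuous_const⟩ fun i => i.elim0 :
    BasicFormula Γ) : UniformSpace.Completion (BasicFormula Γ))⟩

theorem densityChar_le_of_isSeparableLanguage (hL : IsSeparableLanguage.{u, w} L) {n : ℕ}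
    (Γ : Fin n → L.Sorts) :
    densityChar (TFormula.{u, w} (∅ : Set L.Sentence) Γ) ≤ Cardinal.aleph0 :=
  (Cardinal.le_sum (fun Γ : (Σ n : ℕ, (Fin n → L.Sorts)) =>
    densityChar (TFormula.{u, w} (∅ : Set L.Sentence) Γ.2)) ⟨n, Γ⟩).trans hL.le

/-- Each tuple of variables contributes at least `1` to the sum of density characters, so there are
countably many tuples, and already those of length `1` account for all sorts. -/
theorem countable_sorts_of_isSeparableLanguage (hL : IsSeparableLanguage.{u, w} L) :
    Countable L.Sorts := by
  have h : Cardinal.mk (Σ n : ℕ, (Fin n → L.Sorts)) ≤ Cardinal.aleph0 := by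
    rw [← hL, ← mul_one (Cardinal.mk _), ← Cardinal.sum_const']
    exact Cardinal.sum_le_sum _ _ fun Γ => one_le_densityChar _
  have : Countable (Σ n : ℕ, (Fin n → L.Sorts)) := Cardinal.mk_le_aleph0_iff.1 h
  refine Function.Injective.countable (β := Σ n : ℕ, (Fin n → L.Sorts))
    (f := fun s => ⟨1, fun _ => s⟩) fun s s' h => ?_
  simpa [funext_iff] using h

instance _root_.UniformSpace.Completion.isCountablyGenerated_uniformity (X : Type*)
    [UniformSpace X] [(uniformity X).IsCountablyGenerated] :
    (uniformity (UniformSpace.Completion X)).IsCountablyGenerated := by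
  obtain ⟨s, hs⟩ := (uniformity X).exists_antitone_basis
  have h : (uniformity (CauchyFilter X)).IsCountablyGenerated :=
    (CauchyFilter.basis_uniformity hs.1).isCountablyGenerated
  exact Filter.map.isCountablyGenerated (uniformity (CauchyFilter X)) _

/-- A dense subset of the completion need not consist of basic formulas. Second countability, unlike
separability, passes to the space of basic formulas. -/
theorem hasCountableApprox_of_isSeparableLanguage (hL : IsSeparableLanguage.{u, w} L) {n : ℕ}
    (Γ : Fin n → L.Sorts) : HasCountableApprox.{u, w} Γ := by
  let _ := formulaPseudoEMetric.{u, w} (∅ : Set L.Sentence) Γ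
  have : TopologicalSpace.SeparableSpace (UniformSpace.Completion (BasicFormula Γ)) :=
    separableSpace_of_densityChar_le (TFormula.{u, w} (∅ : Set L.Sentence) Γ)
      (densityChar_le_of_isSeparableLanguage hL Γ)
  have : SecondCountableTopology (UniformSpace.Completion (BasicFormula Γ)) :=
    UniformSpace.secondCountable_of_separable _
  have : SecondCountableTopology (BasicFormula Γ) :=
    (UniformSpace.Completion.isUniformInducing_coe (BasicFormula Γ)).isInducing.secondCountableTopology
  obtain ⟨D, hD, hd⟩ := TopologicalSpace.exists_countable_dense (BasicFormula Γ)
  refine ⟨D, hD, fun φ ε hε => ?_⟩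
  obtain ⟨ψ, hψ, h⟩ := EMetric.mem_closure_iff.1 (hd φ) (ENNReal.ofReal ε) (by simpa using hε)
  refine ⟨ψ, hψ, fun M a => (ENNReal.ofReal_le_ofReal_iff hε.le).1 (le_trans ?_ h.le)⟩
  exact le_iSup_of_le M (le_iSup_of_le (fun σ hσ => hσ.elim) (le_iSup_of_le a le_rfl))

/-! ### Generic models with named constants -/

/-- Models of `T` with an interpretation of all constants. -/
structure NamedModel (T : Set L.Sentence) where
  toStructure : Structure.{u, w} L
  models : toStructure.Models T
  const : toStructure.Constants

/-- Basic sentences with constants: a basic formula and numbers for the constants to be substituted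
for its variables. -/
structure ConstSentence (L : MetricLanguage.{u}) where
  {n : ℕ}
  {Γ : Fin n → L.Sorts}
  num : Fin n → ℕ
  formula : BasicFormula Γ

/-- The value of a sentence with constants. -/
noncomputable def ConstSentence.eval (j : ConstSentence L) (M : Structure.{u, w} L)
    (c : M.Constants) : ℝ :=
  j.formula.eval M fun i => c (mkConst j.Γ j.num i)

theorem ConstSentence.isFormulaValue (j : ConstSentence L) :
    IsFormulaValue.{u, w} constSort (Set.range (mkConst j.Γ j.num)) j.eval :=
  IsFormulaValue.of_eval (srt := constSort) (mkConst j.Γ j.num) j.formula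

/-- The sentence with constants obtained by substituting a constant for the first variable. -/
def ConstSentence.instantiate {n : ℕ} {Γ : Fin n → L.Sorts} {s : L.Sorts} (e : Fin n → ℕ)
    (φ : BasicFormula (consSort s Γ)) (k : ℕ) : ConstSentence L :=
  ⟨(Fin.cons k e : Fin (n + 1) → ℕ), φ⟩

theorem ConstSentence.eval_instantiate {n : ℕ} {Γ : Fin n → L.Sorts} {s : L.Sorts}
    (e : Fin n → ℕ) (φ : BasicFormula (consSort s Γ)) (k : ℕ) (M : Structure.{u, w} L)
    (c : M.Constants) : (ConstSentence.instantiate e φ k).eval M c =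
      φ.eval M (M.cons (c ⟨s, k⟩) fun i => c (mkConst Γ e i)) := by
  refine congrArg (φ.eval M) (funext fun i => ?_)
  refine Fin.cases ?_ (fun i => ?_) i <;> rfl

namespace NamedModel

variable {T : Set L.Sentence}

/-- The values of all sentences with constants. -/
noncomputable def diagram (x : NamedModel.{u, w} T) : ConstSentence L → ℝ :=
  fun j => j.eval x.toStructure x.const

/-- The ultraproduct of a sequence of models with constants. -/
noncomputable def ultra (x : ℕ → NamedModel.{u, w} T) (U : Ultrafilter ℕ) :
    NamedModel.{u, w} T where
  toStructure := ultraproduct (fun n => (x n).toStructure) U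
  models := ultraproduct_models _ U fun n => (x n).models
  const q := ultraMk _ U fun n => (x n).const q

theorem tendsto_diagram_ultra (x : ℕ → NamedModel.{u, w} T) (U : Ultrafilter ℕ) :
    Tendsto (fun n => (x n).diagram) U (𝓝 (ultra x U).diagram) :=
  tendsto_pi_nhds.2 fun j => tendsto_eval_ultraproduct (fun n => (x n).toStructure) U j.formula
    fun i n => (x n).const (mkConst j.Γ j.num i)

/-- An open set of diagrams is dense if it meets every open set which contains the diagram of a
model. -/
def IsDenseOpen (T : Set L.Sentence) (O : Set (ConstSentence L → ℝ)) : Prop :=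
  IsOpen O ∧ ∀ V, IsOpen V → ∀ x : NamedModel.{u, w} T, x.diagram ∈ V →
    ∃ y : NamedModel.{u, w} T, y.diagram ∈ V ∩ O

/-- The Baire category theorem for diagrams of models. -/
theorem exists_generic [Nonempty (NamedModel.{u, w} T)] {K : Type*} [Countable K]
    (O : K → Set (ConstSentence L → ℝ)) (hO : ∀ k, IsDenseOpen.{u, w} T (O k)) :
    ∃ x : NamedModel.{u, w} T, ∀ k, x.diagram ∈ O k := by
  rcases isEmpty_or_nonempty K with hK | hK
  · exact ⟨Classical.arbitrary _, fun k => hK.elim k⟩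
  obtain ⟨f, hf⟩ := exists_surjective_nat K
  -- A stage of the construction: a neighbourhood, together with a model whose diagram has it as a
  -- neighbourhood.
  let S := {q : Set (ConstSentence L → ℝ) × NamedModel.{u, w} T // q.1 ∈ 𝓝 q.2.diagram}
  have step : ∀ (k : K) (q : S), ∃ q' : S, IsClosed q'.1.1 ∧ q'.1.1 ⊆ q.1.1 ∩ O k := by
    rintro k ⟨⟨C, x⟩, hC⟩
    obtain ⟨y, hyC, hyO⟩ := (hO k).2 (interior C) isOpen_interior x (mem_interior_iff_mem_nhds.2 hC)
    obtain ⟨C', hC', hcl, hsub⟩ := exists_mem_nhds_isClosed_subset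
      ((isOpen_interior.inter (hO k).1).mem_nhds ⟨hyC, hyO⟩)
    exact ⟨⟨⟨C', y⟩, hC'⟩, hcl, hsub.trans (Set.inter_subset_inter_left _ interior_subset)⟩
  choose nxt hcl hsub using step
  let q : ℕ → S := fun n => Nat.rec ⟨⟨Set.univ, Classical.arbitrary _⟩, univ_mem⟩
    (fun n s => nxt (f n) s) n
  have hq : ∀ n, q (n + 1) = nxt (f n) (q n) := fun n => rfl
  have hanti : Antitone fun n => (q n).1.1 := antitone_nat_of_succ_le fun n => by
    rw [hq]
    exact (hsub (f n) (q n)).trans Set.inter_subset_left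
  let U : Ultrafilter ℕ := hyperfilter ℕ
  refine ⟨ultra (fun n => (q n).1.2) U, fun k => ?_⟩
  obtain ⟨n, rfl⟩ := hf k
  apply (hsub (f n) (q n)).trans Set.inter_subset_right
  -- The neighbourhood at stage `n + 1` is closed and contains the diagrams of all later models,
  -- hence that of the ultraproduct.
  refine (hcl (f n) (q n)).mem_of_tendsto (tendsto_diagram_ultra _ U) ?_
  have hev : ∀ᶠ m in (U : Filter ℕ), n + 1 ≤ m :=
    Nat.hyperfilter_le_atTop (eventually_ge_atTop (n + 1))
  filter_upwards [hev] with m hm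
  rw [← hq]
  exact hanti hm (mem_of_mem_nhds (q m).2)

/-- Neighbourhoods of the diagram of a model are determined by formulas. -/
theorem exists_isFormulaValue (x : NamedModel.{u, w} T) {V : Set (ConstSentence L → ℝ)}
    (hV : IsOpen V) (hx : x.diagram ∈ V) :
    ∃ (F : Set L.Constant) (g : ∀ M : Structure.{u, w} L, M.Constants → ℝ), F.Finite ∧
      IsFormulaValue constSort F g ∧ (∀ M c, 0 ≤ g M c) ∧ g x.toStructure x.const = 0 ∧
      ∀ y : NamedModel.{u, w} T, g y.toStructure y.const < 1 → y.diagram ∈ V := by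
  obtain ⟨I, v, hv, hIV⟩ := isOpen_pi_iff.1 hV x.diagram hx
  have hball : ∀ j, ∃ ρ : ℝ, 0 < ρ ∧ (j ∈ I → Metric.ball (x.diagram j) ρ ⊆ v j) := by
    intro j
    by_cases hj : j ∈ I
    · obtain ⟨ρ, hρ, h⟩ := Metric.isOpen_iff.1 (hv j hj).1 _ (hv j hj).2
      exact ⟨ρ, hρ, fun _ => h⟩
    · exact ⟨1, one_pos, fun h => (hj h).elim⟩
  choose ρ hρ hρv using hball
  -- Dividing by the radii `ρ j` lets the single inequality `g < 1` put every coordinate in its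
  -- ball.
  have hg : IsFormulaValue.{u, w} constSort Set.univ
      fun M c => ∑ j ∈ I, |j.eval M c - x.diagram j| / ρ j :=
    IsFormulaValue.sum I fun j _ => (j.isFormulaValue.mono (Set.subset_univ _)).comp
      (f := fun t => |t - x.diagram j| / ρ j) (by fun_prop)
  have hnn : ∀ (M : Structure.{u, w} L) c, ∀ j ∈ I, 0 ≤ |j.eval M c - x.diagram j| / ρ j :=
    fun M c j _ => div_nonneg (abs_nonneg _) (hρ j).le
  obtain ⟨F, hF, -, hgF⟩ := hg.exists_finite
  refine ⟨F, _, hF, hgF, fun M c => Finset.sum_nonneg (hnn M c), ?_, fun y hy => ?_⟩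
  · exact Finset.sum_eq_zero fun j _ => by simp [diagram]
  · refine hIV fun j hj => hρv j hj ?_
    have h := (Finset.single_le_sum (hnn _ y.const) hj).trans_lt hy
    rwa [div_lt_one (hρ j)] at h

/-- The diagrams in which the supremum of `φ` over its first variable is attained at a constant up
to `ε`. -/
def henkinSet {n : ℕ} {Γ : Fin n → L.Sorts} {s : L.Sorts} (e : Fin n → ℕ)
    (φ : BasicFormula (consSort s Γ)) (ε : ℝ) : Set (ConstSentence L → ℝ) :=
  {x | ∃ k : ℕ, x ⟨e, .sup s φ⟩ < x (.instantiate e φ k) + ε}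

/-- A basic neighbourhood mentions finitely many constants. One that occurs neither there nor in `e`
can be reinterpreted as a near-maximizer without leaving the neighbourhood. -/
theorem isDenseOpen_henkinSet {n : ℕ} {Γ : Fin n → L.Sorts} {s : L.Sorts} (e : Fin n → ℕ)
    (φ : BasicFormula (consSort s Γ)) {ε : ℝ} (hε : 0 < ε) :
    IsDenseOpen.{u, w} T (henkinSet e φ ε) := by
  classical
  constructor
  · simp only [henkinSet, Set.ofPred_exists]
    exact isOpen_iUnion fun k => isOpen_lt (by fun_prop) (by fun_prop)
  · intro V hV x hx
    obtain ⟨F, g, hF, hg, -, hgx, hgV⟩ := x.exists_isFormulaValue hV hx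
    obtain ⟨M, hM, c⟩ := x
    have hfin : {k : ℕ | (⟨s, k⟩ : L.Constant) ∈ F ∪ Set.range (mkConst Γ e)}.Finite :=
      (hF.union (Set.finite_range _)).preimage fun k _ k' _ h => by simpa using h
    obtain ⟨k, hk⟩ := hfin.exists_notMem
    have hk' : (⟨s, k⟩ : L.Constant) ∉ F ∪ Set.range (mkConst Γ e) := hk
    rw [Set.mem_union, not_or] at hk'
    obtain ⟨b, hb⟩ : ∃ b : M.Carrier s,
        (BasicFormula.sup s φ).eval M (fun i => c (mkConst Γ e i)) - ε <
          φ.eval M (M.cons b fun i => c (mkConst Γ e i)) :=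
      exists_lt_of_lt_ciSup (sub_lt_self _ hε)
    let c' : M.Constants := Function.update c (⟨s, k⟩ : L.Constant) b
    have hc' : (fun i => c' (mkConst Γ e i)) = fun i => c (mkConst Γ e i) :=
      funext fun i => Function.update_of_ne (fun h => hk'.2 ⟨i, h⟩) _ _
    have hck : c' ⟨s, k⟩ = b := Function.update_self (⟨s, k⟩ : L.Constant) b c
    refine ⟨⟨M, hM, c'⟩, hgV _ ?_, k, ?_⟩
    · refine lt_of_eq_of_lt ?_ one_pos
      rw [← hgx]
      exact hg.congr fun v hv => Function.update_of_ne (by rintro rfl; exact hk'.1 hv) _ _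
    · change (BasicFormula.sup s φ).eval M (fun i => c' (mkConst Γ e i)) <
        (ConstSentence.instantiate e φ k).eval M c' + ε
      rw [ConstSentence.eval_instantiate, hc', hck]
      linarith

/-- Replacing `φ` by a uniform approximation `ψ` costs `ε / 3` on each side, and the Henkin defect
of `ψ` is below `ε / 3`. -/
theorem henkin_of_diagram_mem {D : ∀ {n : ℕ} (Γ : Fin n → L.Sorts), Set (BasicFormula Γ)}
    (hD : ∀ {n : ℕ} (Γ : Fin n → L.Sorts) (φ : BasicFormula Γ) (ε : ℝ), 0 < ε →
      ∃ ψ ∈ D Γ, ∀ (M : Structure.{u, w} L) (a : M.Tuple Γ), |φ.eval M a - ψ.eval M a| ≤ ε)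
    (x : NamedModel.{u, w} T)
    (hx : ∀ {n : ℕ} (Γ : Fin n → L.Sorts) (s : L.Sorts) (e : Fin n → ℕ),
      ∀ φ ∈ D (consSort s Γ), ∀ m : ℕ, x.diagram ∈ henkinSet e φ (1 / ((m : ℝ) + 1))) :
    x.toStructure.Henkin x.const := by
  intro n Γ e s φ ε hε
  obtain ⟨ψ, hψ, h⟩ := hD _ φ (ε / 3) (by positivity)
  obtain ⟨m, hm⟩ := exists_nat_one_div_lt (show 0 < ε / 3 by positivity)
  obtain ⟨k, hk⟩ := hx Γ s e ψ hψ m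
  have hk' : (BasicFormula.sup s ψ).eval x.toStructure (fun i => x.const (mkConst Γ e i)) <
    (ConstSentence.instantiate e ψ k).eval x.toStructure x.const + 1 / ((m : ℝ) + 1) := hk
  rw [ConstSentence.eval_instantiate] at hk'
  refine ⟨k, ?_⟩
  have h₁ : (BasicFormula.sup s φ).eval x.toStructure (fun i => x.const (mkConst Γ e i)) ≤
      (BasicFormula.sup s ψ).eval x.toStructure (fun i => x.const (mkConst Γ e i)) + ε / 3 :=
    ciSup_le_ciSup_add (ψ.bddAbove_range _ _) fun b => by
      linarith [(abs_le.1 (h x.toStructure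
        (x.toStructure.cons b fun i => x.const (mkConst Γ e i)))).2]
  linarith [(abs_le.1 (h x.toStructure (x.toStructure.cons (x.const ⟨s, k⟩)
    fun i => x.const (mkConst Γ e i)))).1]

end NamedModel

end MetricLanguage

/-- Exhibits the maximum metric as a continuous connective applied to the coordinate distances, so
that it is given by a formula. -/
theorem dist_pi_eq_norm {ι : Type*} [Fintype ι] {X : ι → Type*} [∀ i, PseudoMetricSpace (X i)]
    (x y : ∀ i, X i) : dist x y = ‖fun i => dist (x i) (y i)‖ := by
  apply le_antisymm
  · refine (dist_pi_le_iff (norm_nonneg _)).2 fun i => ?_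
    exact (Real.norm_of_nonneg dist_nonneg).symm.le.trans
      (norm_le_pi_norm (fun i => dist (x i) (y i)) i)
  · refine (pi_norm_le_iff_of_nonneg dist_nonneg).2 fun i => ?_
    rw [Real.norm_of_nonneg dist_nonneg]
    exact dist_le_pi_dist x y i

namespace MetricLanguage

variable {L : MetricLanguage.{u}}

/-! ### Types and their neighbourhoods in the metric -/

theorem IsFormulaValue.relabel {V W : Type*} {srt : V → L.Sorts} {srt' : W → L.Sorts} {F : Set V}
    {g : ∀ M : Structure.{u, w} L, M.Assignment srt → ℝ} (hg : IsFormulaValue srt F g) :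
    IsFormulaValue (Sum.elim srt srt') (Sum.inl '' F)
      fun M (c : M.Assignment (Sum.elim srt srt')) => g M fun v => c (.inl v) := by
  obtain ⟨n, e, he, φ, hφ⟩ := hg
  exact ⟨n, fun i => .inl (e i), fun i => ⟨_, he i, rfl⟩, φ, fun M c => hφ M _⟩

/-- The formula `Ψ(x)` is the infimum over all assignments `c` of the maximum of `g(c)` and
`d(x, c(e)) - η`. -/
def IsInfConvolution {V : Type*} {srt : V → L.Sorts}
    (g : ∀ M : Structure.{u, w} L, M.Assignment srt → ℝ) {n : ℕ} (e : Fin n → V) (η : ℝ)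
    (Ψ : BasicFormula fun i => srt (e i)) : Prop :=
  ∀ (M : Structure.{u, w} L) (a : M.Tuple fun i => srt (e i)),
    (∀ c, Ψ.eval M a ≤ max (g M c) (dist a (fun i => c (e i)) - η)) ∧
    ∀ r, Ψ.eval M a < r → ∃ c, g M c < r ∧ dist a (fun i => c (e i)) < η + r

theorem IsFormulaValue.exists_isInfConvolution {V : Type*} {srt : V → L.Sorts} {F : Set V}
    {g : ∀ M : Structure.{u, w} L, M.Assignment srt → ℝ} (hg : IsFormulaValue srt F g) {n : ℕ}
    (e : Fin n → V) (η : ℝ) : ∃ Ψ, IsInfConvolution g e η Ψ := by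
  classical
  -- The left variables carry `c` and are quantified away; the right ones carry the free tuple `x`,
  -- kept apart from `c(e)`.
  let srt' : V ⊕ Fin n → L.Sorts := Sum.elim srt fun i => srt (e i)
  have hd : IsFormulaValue.{u, w} srt' Set.univ fun M c =>
      Dist.dist (α := M.Tuple fun i => srt (e i)) (fun i => c (.inr i)) fun i => c (.inl (e i)) := by
    have := IsFormulaValue.conn (srt := srt') (F := Set.univ)
      (G := fun (i : Fin n) (M : Structure.{u, w} L) (c : M.Assignment srt') =>
        Dist.dist (c (.inr i) : M.Carrier (srt (e i))) (c (.inl (e i))))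
      (fun i => IsFormulaValue.dist (srt := srt') (v := .inr i) (v' := .inl (e i))
        (s := srt (e i)) (Set.mem_univ _) (Set.mem_univ _) rfl rfl)
      (f := fun x => ‖x‖) continuous_norm
    refine (congrArg _ (funext fun M => funext fun c => ?_)).mp this
    exact (dist_pi_eq_norm (X := fun i => M.Carrier (srt (e i))) _ _).symm
  have hmax := ((hg.relabel (srt' := fun i => srt (e i))).mono (Set.subset_univ _)).comp₂ hd
    (f := fun x => max x.1 (x.2 - η)) (by fun_prop)
  obtain ⟨F', hfin, -, hF'⟩ := hmax.exists_finite
  let Q : Finset (V ⊕ Fin n) := hfin.toFinset.filter fun v => v.isLeft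
  have hsub : F' ⊆ Set.range Sum.inr ∪ (Q : Set (V ⊕ Fin n)) := by
    rintro (v | i) hv
    · exact Or.inr (by simp [Q, hv])
    · exact Or.inl ⟨i, rfl⟩
  obtain ⟨G, hG, hGinf⟩ := (hF'.mono hsub).exists_inf Q
  obtain ⟨Ψ, hΨ⟩ := hG.exists_formula (e := (Sum.inr : Fin n → V ⊕ Fin n)) le_rfl
  refine ⟨Ψ, fun M a => ?_⟩
  let comb : M.Assignment srt → M.Assignment srt' := fun c v =>
    Sum.rec (motive := fun v => M.Carrier (srt' v)) c a v
  have hcomb : ∀ c, Ψ.eval M a = G M (comb c) := fun c => (hΨ M (comb c)).symm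
  refine ⟨fun c => ?_, fun r hr => ?_⟩
  · refine (hcomb c).le.trans ?_
    exact (hGinf M (comb c)).1 (comb c) fun _ _ => rfl
  · obtain ⟨c, hc, hcr⟩ := (hGinf M _).2 r ((hcomb fun v => (M.nonempty _).some).symm.trans_lt hr)
    have ha : (fun i => c (.inr i)) = a := funext fun i => hc (.inr i) (by simp [Q])
    rw [max_lt_iff] at hcr
    refine ⟨fun v => c (.inl v), hcr.1, ?_⟩
    have := hcr.2
    dsimp only at this
    rw [ha] at this
    linarith

variable {T : Set L.Sentence} {n : ℕ} {Γ : Fin n → L.Sorts} {p : BasicFormula Γ → ℝ}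

/-- The tuple `a` is at distance at most `η` from the type `p`: every condition in `p` is
approximately realized in `M` at distance approximately at most `η` from `a`. -/
def Structure.IsNear (M : Structure.{u, w} L) (p : BasicFormula Γ → ℝ) (η : ℝ) (a : M.Tuple Γ) :
    Prop :=
  ∀ θ, p θ = 0 → ∀ r : ℝ, 0 < r → ∃ b : M.Tuple Γ, |θ.eval M b| < r ∧ dist a b < η + r

/-- The formula `φ - r`. -/
def BasicFormula.subConst (φ : BasicFormula Γ) (r : ℝ) : BasicFormula Γ :=
  .conn (k := 1) ⟨fun x => x 0 - r, by fun_prop⟩ fun _ => φ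

theorem BasicFormula.eval_subConst (φ : BasicFormula Γ) (r : ℝ) (M : Structure.{u, w} L)
    (a : M.Tuple Γ) : (φ.subConst r).eval M a = φ.eval M a - r := rfl

theorem apply_subConst_eq_zero (hp : p ∈ typeSpace.{u, w} T Γ) (φ : BasicFormula Γ) :
    p (φ.subConst (p φ)) = 0 := by
  obtain ⟨M, -, a, rfl⟩ := hp
  exact sub_self _

/-- For each `φ`, nearness applied to the condition `φ - p φ` gives tuples arbitrarily close to `b`
at which `φ` is almost `p φ`; uniform continuity concludes. -/
theorem Structure.eq_of_tendsto_of_isNear {M : Structure.{u, w} L} (hp : p ∈ typeSpace.{u, w} T Γ)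
    {a : ℕ → M.Tuple Γ} {b : M.Tuple Γ} {η : ℕ → ℝ} (hη : Tendsto η atTop (𝓝 0))
    (ha : ∀ k, M.IsNear p (η k) (a k)) (hab : Tendsto a atTop (𝓝 b)) : M.tp b = p := by
  funext φ
  refine eq_of_abs_sub_le_all fun ε hε => ?_
  obtain ⟨δ, hδ, h⟩ := φ.uniformContinuous (ε / 2) (by positivity)
  have h₁ : ∀ᶠ k in atTop, η k < δ / 4 := hη.eventually_lt_const (by positivity)
  have h₂ : ∀ᶠ k in atTop, dist (a k) b < δ / 2 :=
    (Metric.tendsto_nhds.1 hab) _ (by positivity)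
  obtain ⟨k, hk₁, hk₂⟩ := (h₁.and h₂).exists
  obtain ⟨b', hb', hd⟩ := ha k _ (apply_subConst_eq_zero hp φ) (min (δ / 4) (ε / 2))
    (by positivity)
  rw [BasicFormula.eval_subConst] at hb'
  have hbb' : dist b b' < δ := by
    have := dist_triangle_left b b' (a k)
    linarith [min_le_left (δ / 4) (ε / 2)]
  have h₃ := h M b b' ((dist_pi_lt_iff hδ).1 hbb')
  have h₄ := abs_sub_le (φ.eval M b) (φ.eval M b') (p φ)
  change |φ.eval M b - p φ| ≤ ε
  linarith [min_le_right (δ / 4) (ε / 2)]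

/-- A type is principal if every metric neighbourhood of it contains a logical neighbourhood. -/
theorem isPrincipal_of_isNear (hp : p ∈ typeSpace.{u, w} T Γ)
    (h : ∀ η : ℝ, 0 < η → ∃ φ, p φ = 0 ∧ ∃ δ : ℝ, 0 < δ ∧
      ∀ M : Structure.{u, w} L, M.Models T → ∀ a, φ.eval M a < δ → M.IsNear p η a) :
    IsPrincipal.{u, w} T p := by
  intro ε hε
  have hη : ∀ k : ℕ, 0 < ε / 4 / 2 ^ k := fun k => by positivity
  choose φ hφ δ hδ hnear using fun k => h _ (hη k)
  refine ⟨φ 0, δ 0, hδ 0, fun M hM => ⟨fun a ha => ?_, fun a ha => ?_⟩⟩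
  · have ha' : M.tp a = p := ha
    rw [← hφ 0, ← ha']
    rfl
  -- A tuple in the `k`-th logical neighbourhood is near `p`, so a tuple of the next one lies within
  -- `2 * (ε / 4 / 2 ^ k)`. These distances sum to `ε`, and the limit realizes `p`; in particular
  -- `p` is realized in `M`.
  have step : ∀ k (b : M.Tuple Γ), ∃ b' : M.Tuple Γ, (φ k).eval M b < δ k →
      (φ (k + 1)).eval M b' < δ (k + 1) ∧ dist b b' ≤ ε / 2 / 2 ^ k := by
    intro k b
    by_cases hb : (φ k).eval M b < δ k
    · obtain ⟨b', h₁, h₂⟩ := hnear k M hM b hb _ (hφ (k + 1)) (min (δ (k + 1)) (ε / 4 / 2 ^ k))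
        (lt_min (hδ _) (hη k))
      refine ⟨b', fun _ => ⟨(le_abs_self _).trans_lt (h₁.trans_le (min_le_left _ _)), ?_⟩⟩
      have : ε / 2 / 2 ^ k = ε / 4 / 2 ^ k + ε / 4 / 2 ^ k := by ring
      linarith [min_le_right (δ (k + 1)) (ε / 4 / 2 ^ k)]
    · exact ⟨b, fun h => (hb h).elim⟩
  choose nxt hnxt using step
  let s : ℕ → M.Tuple Γ := fun k => Nat.rec a nxt k
  have hs : ∀ k, (φ k).eval M (s k) < δ k := by
    intro k
    induction k with
    | zero => exact ha
    | succ k ih => exact (hnxt k (s k) ih).1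
  have hd : ∀ k, dist (s k) (s (k + 1)) ≤ ε / 2 / 2 ^ k := fun k => (hnxt k (s k) (hs k)).2
  obtain ⟨b, hb⟩ := cauchySeq_tendsto_of_complete (cauchySeq_of_le_geometric_two hd)
  have hlim : Tendsto (fun k : ℕ => ε / 4 / 2 ^ k) atTop (𝓝 0) := by
    have := (tendsto_pow_atTop_nhds_zero_of_lt_one (r := (1 / 2 : ℝ)) (by norm_num)
      (by norm_num)).const_mul (ε / 4)
    simpa [div_eq_mul_inv] using this
  have hbp : b ∈ M.realizations p :=
    Structure.eq_of_tendsto_of_isNear hp hlim (fun k => hnear k M hM _ (hs k)) hb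
  refine (Metric.infEDist_le_edist_of_mem hbp).trans ?_
  rw [edist_dist]
  refine ENNReal.ofReal_le_ofReal ?_
  exact dist_le_of_le_geometric_two_of_tendsto₀ hd hb

theorem exists_not_isNear_of_not_isPrincipal (hp : p ∈ typeSpace.{u, w} T Γ)
    (h : ¬ IsPrincipal.{u, w} T p) : ∃ η : ℝ, 0 < η ∧ ∀ φ, p φ = 0 → ∀ δ : ℝ, 0 < δ →
      ∃ M : Structure.{u, w} L, M.Models T ∧ ∃ a, φ.eval M a < δ ∧ ¬ M.IsNear p η a := by
  contrapose! h
  exact isPrincipal_of_isNear hp h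

/-! ### Omitting types -/

namespace NamedModel

/-- The diagrams in which the tuple of constants with numbers `e` is at distance more than `η`
from the type `p`. -/
def omittingSet (p : BasicFormula Γ → ℝ) (η : ℝ) (e : Fin n → ℕ) : Set (ConstSentence L → ℝ) :=
  {x | ∃ θ Ψ : BasicFormula Γ, (p θ = 0 ∧ IsInfConvolution.{u, w} (srt := Γ)
    (fun M a => |θ.eval M a|) (fun i => i) η Ψ) ∧ 0 < x ⟨e, Ψ⟩}

/-- A failure of nearness is witnessed by a single condition `θ`, and it makes the infimal
convolution of `|θ|` positive. Positivity of one formula is an open condition, whereas the failure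
itself is not visibly one. -/
theorem mem_omittingSet_of_not_isNear (x : NamedModel.{u, w} T) {η : ℝ} {e : Fin n → ℕ}
    (h : ¬ x.toStructure.IsNear p η fun i => x.const (mkConst Γ e i)) :
    x.diagram ∈ omittingSet.{u, w} p η e := by
  unfold Structure.IsNear at h
  push Not at h
  obtain ⟨θ, hθ, r, hr, h⟩ := h
  have hθv : IsFormulaValue.{u, w} Γ (Set.range fun i => i) fun M a => |θ.eval M a| :=
    (IsFormulaValue.of_eval (srt := Γ) (fun i => i) θ).comp continuous_abs
  obtain ⟨Ψ, hΨ⟩ := hθv.exists_isInfConvolution (fun i => i) η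
  refine ⟨θ, Ψ, ⟨hθ, hΨ⟩, lt_of_not_ge fun hle => ?_⟩
  obtain ⟨b, hb, hd⟩ := (hΨ x.toStructure _).2 r (lt_of_le_of_lt hle hr)
  exact absurd hd (not_lt.2 (h b hb))

/-- Suppose `V` is given near `x` by `g < 1`, and the tuple named by `e` in `x` is `η / 3`-near `p`.
Let `φ(a)` say that `a` is within `η / 3` of the `e`-tuple of some constants with `g = 0`. Nearness
forces `p φ = 0`, so by hypothesis `φ` is small at some `a` which is not `η`-near `p`. The resulting
constants stay in `V`, and their `e`-tuple is too close to `a` to be near `p`. -/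
theorem isDenseOpen_omittingSet (hp : p ∈ typeSpace.{u, w} T Γ) {η : ℝ} (hη : 0 < η)
    (h : ∀ φ, p φ = 0 → ∀ δ : ℝ, 0 < δ →
      ∃ M : Structure.{u, w} L, M.Models T ∧ ∃ a, φ.eval M a < δ ∧ ¬ M.IsNear p η a)
    (e : Fin n → ℕ) : IsDenseOpen.{u, w} T (omittingSet.{u, w} p (η / 3) e) := by
  constructor
  · simp only [omittingSet, Set.ofPred_exists]
    exact isOpen_iUnion fun θ => isOpen_iUnion fun Ψ =>
      isOpen_const.and (isOpen_lt (by fun_prop) (by fun_prop))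
  intro V hV x hx
  by_cases hnear : x.toStructure.IsNear p (η / 3) fun i => x.const (mkConst Γ e i)
  swap
  · exact ⟨x, hx, x.mem_omittingSet_of_not_isNear hnear⟩
  obtain ⟨F, g, -, hg, hg0, hgx, hgV⟩ := x.exists_isFormulaValue hV hx
  -- Restated so that the context is `Γ` itself; the sorts of `mkConst Γ e` agree with it only by
  -- unfolding.
  obtain ⟨φ, hφ⟩ : ∃ φ : BasicFormula Γ, ∀ (M : Structure.{u, w} L) (a : M.Tuple Γ),
      (∀ c : M.Constants, φ.eval M a ≤
        max (g M c) (dist (α := M.Tuple Γ) a (fun i => c (mkConst Γ e i)) - η / 3)) ∧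
      ∀ r, φ.eval M a < r → ∃ c : M.Constants, g M c < r ∧
        dist a (fun i => c (mkConst Γ e i)) < η / 3 + r := by
    obtain ⟨φ, hφ⟩ := hg.exists_isInfConvolution (mkConst Γ e) (η / 3)
    exact ⟨φ, hφ⟩
  have hφ0 : ∀ (M : Structure.{u, w} L) (a : M.Tuple Γ), 0 ≤ φ.eval M a := by
    intro M a
    by_contra! hneg
    obtain ⟨c, hc, -⟩ := (hφ M a).2 0 hneg
    exact absurd hc (not_lt.2 (hg0 M c))
  have hpφ : p φ = 0 := by
    refine le_antisymm (not_lt.1 fun hpos => ?_) ?_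
    · obtain ⟨b, hb, hd⟩ := hnear _ (apply_subConst_eq_zero hp φ) (p φ / 2) (half_pos hpos)
      rw [BasicFormula.eval_subConst] at hb
      have h₁ := (hφ x.toStructure b).1 x.const
      rw [hgx] at h₁
      rw [dist_comm] at hd
      have h₂ : max 0 (dist (α := x.toStructure.Tuple Γ) b
          (fun i => x.const (mkConst Γ e i)) - η / 3) < p φ / 2 :=
        max_lt (half_pos hpos) (by linarith)
      linarith [(abs_lt.1 hb).1, h₁.trans_lt h₂]
    · obtain ⟨M, -, a, rfl⟩ := hp
      exact hφ0 M a
  -- The bound `1` keeps the new diagram in `V`. The bound `η / 3` puts `a` within `2 * η / 3` of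
  -- the `e`-tuple, leaving `η / 3` for the distance from there to `p`.
  obtain ⟨M, hM, a, ha, hna⟩ := h φ hpφ (min 1 (η / 3)) (by positivity)
  obtain ⟨c, hc, hd⟩ := (hφ M a).2 _ ha
  refine ⟨⟨M, hM, c⟩, hgV _ (hc.trans_le (min_le_left _ _)),
    mem_omittingSet_of_not_isNear _ fun hn => hna fun θ hθ r hr => ?_⟩
  obtain ⟨b, hb, hdb⟩ := hn θ hθ r hr
  refine ⟨b, hb, ?_⟩
  have := dist_triangle a (fun i => c (mkConst Γ e i)) b
  have hdb' : dist (α := M.Tuple Γ) (fun i => c (mkConst Γ e i)) b < η / 3 + r := hdb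
  linarith [min_le_right 1 (η / 3)]

/-- A realization `a` would lie within `η` of a tuple of constants and satisfy `θ(a) = 0`, also in
the ambient model. Used as a competitor in the infimum `Ψ`, it makes `Ψ ≤ 0` at that tuple. -/
theorem omits_of_mem_omittingSet (x : NamedModel.{u, w} T) (hx : x.toStructure.Henkin x.const)
    {η : ℝ} (hη : 0 < η) (h : ∀ e : Fin n → ℕ, x.diagram ∈ omittingSet.{u, w} p η e) :
    (x.toStructure.constSubstructure x.const hx).Omits p := by
  rintro ⟨a, ha⟩
  obtain ⟨e, he⟩ := Structure.exists_const_near (fun i => Structure.inclusion hx (a i))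
    (fun i => (a i).2) hη
  obtain ⟨θ, Ψ, ⟨hθ, hΨ⟩, hpos⟩ := h e
  have h₁ := (hΨ x.toStructure fun i => x.const (mkConst Γ e i)).1
    fun i => Structure.inclusion hx (a i)
  have h₂ : θ.eval x.toStructure (fun i => Structure.inclusion hx (a i)) = 0 := by
    rw [← Structure.eval_constSubstructure, ← hθ, ← ha]
    rfl
  have h₃ : dist (α := x.toStructure.Tuple Γ) (fun i => x.const (mkConst Γ e i))
      (fun i => Structure.inclusion hx (a i)) < η :=
    (dist_pi_lt_iff hη).2 fun i => (dist_comm _ _).trans_lt (he i)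
  dsimp only at h₁
  rw [h₂, abs_zero] at h₁
  exact absurd (h₁.trans (max_le le_rfl (sub_nonpos.2 h₃.le))) (not_le.2 hpos)

end NamedModel

/-- The **omitting types theorem** for theories in a separable metric language. -/
theorem exists_separable_model_omitting (L : MetricLanguage.{u})
    (hL : IsSeparableLanguage.{u, w} L)
    (T : Set L.Sentence) (hT : IsTheory.{u, w} T)
    {ι : Type*} [Countable ι] (n : ι → ℕ) (Γ : ∀ k : ι, Fin (n k) → L.Sorts)
    (p : ∀ k : ι, BasicFormula (Γ k) → ℝ)
    (hp : ∀ k, p k ∈ typeSpace.{u, w} T (Γ k))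
    (hnp : ∀ k, ¬ IsPrincipal.{u, w} T (p k)) :
    ∃ M : Structure.{u, w} L,
      M.Models T ∧ M.IsSeparable ∧ ∀ k, M.Omits (p k) := by
  have := countable_sorts_of_isSeparableLanguage hL
  obtain ⟨M₀, hM₀⟩ := hT
  have : Nonempty (NamedModel.{u, w} T) := ⟨⟨M₀, hM₀, fun q => (M₀.nonempty _).some⟩⟩
  choose D hDc hD using fun (n : ℕ) (Γ : Fin n → L.Sorts) =>
    hasCountableApprox_of_isSeparableLanguage hL Γ
  choose η hη hη' using fun k => exists_not_isNear_of_not_isPrincipal (hp k) (hnp k)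
  have hcount : ∀ (n : ℕ) (Γ : Fin n → L.Sorts), Countable (D n Γ) :=
    fun n Γ => (hDc n Γ).to_subtype
  -- Countability of this index type rests on the countability of the sorts and of the approximating
  -- sets `D`.
  let O₁ : (Σ q : (Σ n : ℕ, (Fin n → L.Sorts)), Σ s : L.Sorts,
      (Fin q.1 → ℕ) × D (q.1 + 1) (consSort s q.2) × ℕ) → Set (ConstSentence L → ℝ) :=
    fun q => NamedModel.henkinSet q.2.2.1 q.2.2.2.1.1 (1 / ((q.2.2.2.2 : ℝ) + 1))
  let O₂ : (Σ k : ι, Fin (n k) → ℕ) → Set (ConstSentence L → ℝ) :=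
    fun q => NamedModel.omittingSet.{u, w} (p q.1) (η q.1 / 3) q.2
  obtain ⟨x, hx⟩ := NamedModel.exists_generic (T := T) (Sum.elim O₁ O₂) (by
    rintro (q | q)
    · exact NamedModel.isDenseOpen_henkinSet _ _ (by positivity)
    · exact NamedModel.isDenseOpen_omittingSet (hp q.1) (hη q.1) (hη' q.1) q.2)
  have hHenkin : x.toStructure.Henkin x.const :=
    NamedModel.henkin_of_diagram_mem (D := fun {n} Γ => D n Γ) (fun Γ => hD _ Γ) x
      fun {n} Γ s e φ hφ m => hx (.inl ⟨⟨n, Γ⟩, s, e, ⟨φ, hφ⟩, m⟩)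
  exact ⟨x.toStructure.constSubstructure x.const hHenkin,
    Structure.constSubstructure_models hHenkin x.models,
    Structure.constSubstructure_isSeparable hHenkin,
    fun k => x.omits_of_mem_omittingSet hHenkin (η := η k / 3) (by linarith [hη k])
      fun e => hx (.inr ⟨k, e⟩)⟩

end MetricLanguage

end

theorem mainTheorem4 (L : MetricLanguage.{u})
    (hL : MetricLanguage.IsSeparableLanguage.{u, w} L)
    (T : Set L.Sentence) (hT : MetricLanguage.IsTheory.{u, w} T)
    {ι : Type*} [Countable ι] (n : ι → ℕ) (Γ : ∀ k : ι, Fin (n k) → L.Sorts)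
    (p : ∀ k : ι, MetricLanguage.BasicFormula (Γ k) → ℝ)
    (hp : ∀ k, p k ∈ MetricLanguage.typeSpace.{u, w} T (Γ k))
    (hnp : ∀ k, ¬ MetricLanguage.IsPrincipal.{u, w} T (p k)) :
    ∃ M : MetricLanguage.Structure.{u, w} L,
      M.Models T ∧ M.IsSeparable ∧ ∀ k, M.Omits (p k) :=
  MetricLanguage.exists_separable_model_omitting L hL T hT n Γ p hp hnp
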